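/- Setting. Let $G$ be a Feynman graph: a finite connected directed multigraph with internal edges $e$ of mass $m_e$ and external edges $x$ of mass $M_x$, each external edge being attached to one vertex. Let $d\ge 1$ be the space-time dimension and $q^2=(q^0)^2-(q^1)^2-\dots-(q^{d-1})^2$. Let $\mathcal S=\mathcal S(G_0)$ be the space of complex external momenta $p=(p_x)$ that satisfy total momentum conservation and $p_x^2=M_x^2$ for all $x$. For a set of internal edges, contracting it gives a graph $G^\kappa$, and contracting the remaining internal edges is a contraction $\kappa\colon G^\kappa\twoheadrightarrow G_0$ onto the graph with one vertex and no internal edges. The Pham locus $\mathcal P_\kappa\subset\mathcal S$ is the set of $p$ for which there are complex momenta $q_e$ of the internal edges of $G^\kappa$, conserved at every vertex, with $q_e^2=m_e^2$ for all $e$, and complex numbers $\alpha_e$, not all zero, such that $\sum_e b_{ce}\alpha_e q_e=0$ for every circuit $c$ of $G^\kappa$ (with circuit matrix $b_{ce}$). The Feynman integral $$I_G(p)=\lim_{\varepsilon\to0^+}\int\prod_c d^dk_c\prod_e\frac1{q_e(k,p)^2-m_e^2+i\varepsilon},$$ where $k_c$ are independent loop momenta and the energies are integrated first, is considered where it converges.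 A branch of $I_G$ at $p\in\mathcal S$ is a germ at $p$ of a holomorphic function on $\mathcal S$ obtained by analytic continuation along a path in $\mathcal S$ from a holomorphic germ that equals $I_G$ at the real points near some physical point (real, on shell, all external energies nonzero). Two subsets $A,B\subset\mathcal S$ intersect transversally at $p^*\in A\cap B$ if near $p^*$ the set $\mathcal S$ is a complex manifold, $A$ and $B$ are complex submanifolds of it (of any codimension), and $T_{p^*}A+T_{p^*}B=T_{p^*}\mathcal S$. For a germ $f$ at $p\in\Omega=(U\cap\mathcal S)\setminus(A\cup B)$, $\mathscr M_A f$ denotes the analytic continuation of $f$ along a simple loop around $A$ in $\Omega$: a loop based at $p$ that goes inside $\Omega$ to the boundary of a closed holomorphic disc in $U\cap\mathcal S$ which avoids $B$, meets $A$ only at its centre and is transverse to $A$ there, goes once counterclockwise around this boundary, and returns the same way. $\mathscr M_B$ is defined likewise. Theorem. Let $\mathcal P_{\kappa'}$ and $\mathcal P_{\kappa''}$ be two Pham loci of $G$ that intersect transversally at $p^*$. Then there are arbitrarily small open neighbourhoods $U$ of $p^*$ with the following property. Let $p\in\Omega=(U\cap\mathcal S)\setminus(\mathcal P_{\kappa'}\cup\mathcal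 P_{\kappa''})$ and let $I_G$ be a branch of the Feynman integral at $p$ that has no other singularities in $U$, that is, which can be continued analytically along every path in $\Omega$ starting at $p$. Then the discontinuities $(1-\mathscr M_{\mathcal P_{\kappa'}})I_G$ and $(1-\mathscr M_{\mathcal P_{\kappa''}})I_G$ and both sequential discontinuities exist and do not depend on the simple loops used, and the sequential discontinuities commute: $$(1-\mathscr M_{\mathcal P_{\kappa'}})(1-\mathscr M_{\mathcal P_{\kappa''}})\,I_G(p)=(1-\mathscr M_{\mathcal P_{\kappa''}})(1-\mathscr M_{\mathcal P_{\kappa'}})\,I_G(p).$$ -/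

import Mathlib

open Filter Topology MeasureTheory
open scoped Classical

/-! ### Feynman graphs, contractions, on-shell spaces and Pham loci -/

/-- A Feynman graph whose external edges are labelled by `X`: a finite connected directed
multigraph (multiple edges and self-loops allowed) with internal edges `Eint`, together with the
external edges, each attached to one vertex, and a mass for every edge.
`extSign x = 1` if the external edge `x` starts at its vertex and `-1` if it ends there. -/
structure FeynmanGraph (X : Type) where
  V : Type
  Eint : Type
  [finiteV : Finite V]
  [fintypeEint : Fintype Eint]
  src : Eint → V
  tgt : Eint → V
  extVertex : X → V
  extSign : X → ℤˣ
  mass : Eint → ℝ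
  extMass : X → ℝ
  nonempty : Nonempty V
  connected : ∀ v w : V, Relation.EqvGen (fun a b => ∃ e, src e = a ∧ tgt e = b) v w

attribute [instance] FeynmanGraph.finiteV FeynmanGraph.fintypeEint

/-- The Minkowski square `(q⁰)² - (q¹)² - ⋯ - (qˢ)²` in space-time dimension `d = s + 1`. -/
def minkowskiSq {R : Type} [CommRing R] {s : ℕ} (q : Fin (s + 1) → R) : R :=
  q 0 ^ 2 - ∑ i : Fin s, q i.succ ^ 2

namespace FeynmanGraph

noncomputable section

variable {X : Type}

/-- Incidence matrix on internal edges. -/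
def inc (G : FeynmanGraph X) (v : G.V) (e : G.Eint) : ℤ :=
  (if G.src e = v then 1 else 0) - (if G.tgt e = v then 1 else 0)

/-- Incidence matrix on external edges. -/
def extInc (G : FeynmanGraph X) (v : G.V) (x : X) : ℤ :=
  if G.extVertex x = v then (G.extSign x : ℤ) else 0

/-- Conservation of momentum at every vertex. -/
def Conserves [Fintype X] (G : FeynmanGraph X) {R : Type} [CommRing R] {s : ℕ}
    (q : G.Eint → Fin (s + 1) → R) (p : X → Fin (s + 1) → R) : Prop :=
  ∀ v : G.V, ∑ e, G.inc v e • q e + ∑ x, G.extInc v x • p x = 0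

/-- The lattice of circulations (integer combinations of circuits) of internal edges. -/
def cycles (G : FeynmanGraph X) : Submodule ℤ (G.Eint → ℤ) where
  carrier := {c | ∀ v : G.V, ∑ e, G.inc v e * c e = 0}
  zero_mem' := by intro v; simp
  add_mem' := by
    intro a b ha hb v
    replace ha : ∀ v : G.V, ∑ e, G.inc v e * a e = 0 := ha
    replace hb : ∀ v : G.V, ∑ e, G.inc v e * b e = 0 := hb
    simp [mul_add, Finset.sum_add_distrib, ha v, hb v]
  smul_mem' := by
    intro n a ha v
    replace ha : ∀ v : G.V, ∑ e, G.inc v e * a e = 0 := ha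
    have h : ∀ e, G.inc v e * (n • a) e = n * (G.inc v e * a e) := by
      intro e; simp only [Pi.smul_apply, smul_eq_mul]; ring
    simp only [h, ← Finset.mul_sum, ha v, mul_zero]

/-- The contraction of the graph along the set `C` of internal edges: the end points of the edges
of `C` are identified and the edges of `C` are deleted. -/
def contract (G : FeynmanGraph X) (C : Set G.Eint) : FeynmanGraph X where
  V := Quot (fun v w : G.V => ∃ e ∈ C, G.src e = v ∧ G.tgt e = w)
  Eint := {e : G.Eint // e ∉ C}
  finiteV := Finite.of_surjective (Quot.mk _) Quot.mk_surjective
  fintypeEint := inferInstance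
  src := fun e => Quot.mk _ (G.src e.1)
  tgt := fun e => Quot.mk _ (G.tgt e.1)
  extVertex := fun x => Quot.mk _ (G.extVertex x)
  extSign := G.extSign
  mass := fun e => G.mass e.1
  extMass := G.extMass
  nonempty := G.nonempty.map (Quot.mk _)
  connected := by
    intro v w
    induction v using Quot.ind with | _ v => ?_
    induction w using Quot.ind with | _ w => ?_
    have h := G.connected v w
    induction h with
    | rel a b hab =>
      obtain ⟨e, rfl, rfl⟩ := hab
      by_cases he : e ∈ C
      · have : (Quot.mk (fun v w : G.V => ∃ e ∈ C, G.src e = v ∧ G.tgt e = w) (G.src e))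
            = Quot.mk _ (G.tgt e) := Quot.sound ⟨e, he, rfl, rfl⟩
        rw [this]
        exact Relation.EqvGen.refl _
      · exact Relation.EqvGen.rel _ _ ⟨⟨e, he⟩, rfl, rfl⟩
    | refl a => exact Relation.EqvGen.refl _
    | symm a b _ ih => exact Relation.EqvGen.symm _ _ ih
    | trans a b c _ _ ih₁ ih₂ => exact Relation.EqvGen.trans _ _ _ ih₁ ih₂

/-- The space `𝒮(G₀)` of complex, on-shell, conserved external momenta. -/
def extOnShell [Fintype X] (G : FeynmanGraph X) (s : ℕ) : Set (X → Fin (s + 1) → ℂ) :=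
  {p | ∑ x, (G.extSign x : ℤ) • p x = 0 ∧ ∀ x, minkowskiSq (p x) = (G.extMass x : ℂ) ^ 2}

/-- The set of external momenta for which all internal edges of `G` can be put on shell, with
parameters `α`, not all zero, satisfying the Landau loop equation of every circuit of `G`. -/
def landauLocus [Fintype X] (G : FeynmanGraph X) (s : ℕ) : Set (X → Fin (s + 1) → ℂ) :=
  {p | p ∈ G.extOnShell s ∧ ∃ (q : G.Eint → Fin (s + 1) → ℂ) (α : G.Eint → ℂ),
    G.Conserves q p ∧ (∀ e, minkowskiSq (q e) = (G.mass e : ℂ) ^ 2) ∧ α ≠ 0 ∧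
    ∀ c ∈ G.cycles, ∑ e, c e • α e • q e = 0}

/-- The Pham locus of the contraction `G ↠ Gᵏ ↠ G₀`, where `Gᵏ` is obtained from `G` by
contracting the edges of `C`. -/
def phamLocus [Fintype X] (G : FeynmanGraph X) (s : ℕ) (C : Set G.Eint) :
    Set (X → Fin (s + 1) → ℂ) :=
  (G.contract C).landauLocus s

/-! ### The Feynman integral -/

/-- The momentum of the edge `e`: a routing `q₀` of the external momenta plus the loop momenta,
with energies `k0` and spatial parts `k`, along the loops `b`. -/
def loopMomentum (G : FeynmanGraph X) {s L : ℕ} (b : Fin L → G.Eint → ℤ)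
    (q₀ : G.Eint → Fin (s + 1) → ℝ) (k0 : Fin L → ℝ) (k : Fin L → Fin s → ℝ) (e : G.Eint) :
    Fin (s + 1) → ℝ :=
  q₀ e + ∑ c, b c e • (Fin.cons (k0 c) (k c) : Fin (s + 1) → ℝ)

/-- The product of the propagators `1 / (q_e² - m_e² + iε)`. -/
def integrand (G : FeynmanGraph X) {s L : ℕ} (b : Fin L → G.Eint → ℤ)
    (q₀ : G.Eint → Fin (s + 1) → ℝ) (ε : ℝ) (k0 : Fin L → ℝ) (k : Fin L → Fin s → ℝ) : ℂ :=
  ∏ e, ((minkowskiSq (G.loopMomentum b q₀ k0 k e) - G.mass e ^ 2 : ℝ) + Complex.I * ε)⁻¹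

/-- The scalar Feynman integral of `G` at the real external momenta `p` converges, with value `I`:
the limit for `ε → 0⁺` of the integral of the propagators over the independent loop momenta, the
energies being integrated first (the Minkowskian integral does not converge absolutely in all
variables together). The value does not depend on the basis `b` of the loops nor on the routing
`q₀` of the external momenta. -/
def HasFeynmanIntegral [Fintype X] (G : FeynmanGraph X) {s : ℕ} (p : X → Fin (s + 1) → ℝ)
    (I : ℂ) : Prop :=
  ∃ (L : ℕ) (b : Module.Basis (Fin L) ℤ G.cycles) (q₀ : G.Eint → Fin (s + 1) → ℝ),
    G.Conserves q₀ p ∧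
    (∀ᶠ ε in 𝓝[>] (0 : ℝ),
      (∀ᵐ k : Fin L → Fin s → ℝ,
        Integrable fun k0 : Fin L → ℝ => G.integrand (fun c => (b c).1) q₀ ε k0 k) ∧
      Integrable fun k : Fin L → Fin s → ℝ =>
        ∫ k0 : Fin L → ℝ, G.integrand (fun c => (b c).1) q₀ ε k0 k) ∧
    Tendsto (fun ε : ℝ => ∫ k : Fin L → Fin s → ℝ, ∫ k0 : Fin L → ℝ,
      G.integrand (fun c => (b c).1) q₀ ε k0 k) (𝓝[>] 0) (𝓝 I)

end

end FeynmanGraph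

/-! ### Holomorphic functions on a subset and analytic continuation -/

section Continuation

variable {E : Type*} [NormedAddCommGroup E] [NormedSpace ℂ E]

/-- `f` is holomorphic on the analytic set `S` near `x`: near `x`, on `S`, it is the restriction of
a holomorphic function of the ambient space. -/
def HolomorphicAtOn (S : Set E) (f : E → ℂ) (x : E) : Prop :=
  ∃ h : E → ℂ, AnalyticAt ℂ h x ∧ f =ᶠ[𝓝[S] x] h

/-- The germ `g` at `q` is the analytic continuation along the path `γ` in `S` of the germ `f` at
`p` (germs of functions on `S`). -/
def IsContinuation (S : Set E) {p q : E} (γ : Path p q)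
    (f : Germ (𝓝[S] p) ℂ) (g : Germ (𝓝[S] q) ℂ) : Prop :=
  (∀ t, γ t ∈ S) ∧ ∃ F : unitInterval → E → ℂ,
    (∀ t, HolomorphicAtOn S (F t) (γ t)) ∧
    (∀ t, ∀ᶠ u in 𝓝 t, F u =ᶠ[𝓝[S] (γ u)] F t) ∧
    (F 0 : Germ (𝓝[S] p) ℂ) = f ∧ (F 1 : Germ (𝓝[S] q) ℂ) = g

/-- The germ `f` at `p` has no singularity in `Ω ⊆ S`: it continues along every path in `Ω`. -/
def ContinuesAlongPathsIn (S Ω : Set E) {p : E} (f : Germ (𝓝[S] p) ℂ) : Prop :=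
  ∀ (q : E) (γ : Path p q), (∀ t, γ t ∈ Ω) → ∃ g, IsContinuation S γ f g

/-! ### Submanifolds, transversality -/

/-- The tangent space of `M` at `x`. -/
def tangentSpaceAt (M : Set E) (x : E) : Submodule ℂ E :=
  Submodule.span ℂ (tangentConeAt ℂ M x)

/-- Near `x`, the set `M` is a complex submanifold of `N`: it is cut out in `N` by finitely many
holomorphic equations whose differentials are independent on the tangent space of `N`. -/
def IsSubmanifoldAt (N M : Set E) (x : E) : Prop :=
  ∃ (k : ℕ) (F : E → Fin k → ℂ), AnalyticAt ℂ F x ∧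
    (∀ᶠ y in 𝓝 x, y ∈ M ↔ y ∈ N ∧ F y = 0) ∧
    ∀ w : Fin k → ℂ, ∃ v ∈ tangentSpaceAt N x, fderiv ℂ F x v = w

/-- `A` and `B` intersect transversally in `S` at the point `x`: near `x`, `S` is a complex
manifold, `A` and `B` are submanifolds of `S` through `x`, and `T_x A + T_x B = T_x S`. -/
def IntersectTransversallyAt (S A B : Set E) (x : E) : Prop :=
  x ∈ A ∧ x ∈ B ∧ IsSubmanifoldAt Set.univ S x ∧
    IsSubmanifoldAt S A x ∧ IsSubmanifoldAt S B x ∧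
    tangentSpaceAt A x ⊔ tangentSpaceAt B x = tangentSpaceAt S x

/-! ### Monodromies and discontinuities -/

/-- `η` is a simple loop around `P` in `Y`: it goes from its base point to the boundary of a
holomorphic disc `φ` in `Y` which meets `P` exactly at its centre and is transverse to `P` there,
runs once counterclockwise around the boundary of the disc, and returns the way it came. -/
def IsSimpleLoopAround (Y P : Set E) {p : E} (η : Path p p) : Prop :=
  ∃ (φ : ℂ → E) (γ : Path p (φ 1)) (c : Path (φ 1) (φ 1)),
    AnalyticOnNhd ℂ φ (Metric.closedBall 0 1) ∧
    φ 0 ∈ Y ∩ P ∧ deriv φ 0 ∉ tangentSpaceAt P (φ 0) ∧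
    (∀ z : ℂ, ‖z‖ ≤ 1 → z ≠ 0 → φ z ∈ Y \ P) ∧
    (∀ t, c t = φ (Complex.exp (2 * Real.pi * Complex.I * (t : ℝ)))) ∧
    (∀ t, γ t ∈ Y \ P) ∧
    η = (γ.trans c).trans γ.symm

/-- `d = (1 - 𝓜_P) f`, where `𝓜_P f` is the continuation of the germ `f` (of a function on `S`)
along a simple loop around `P` in `Y`. -/
def IsDiscontinuity (S Y P : Set E) {p : E} (f d : Germ (𝓝[S] p) ℂ) : Prop :=
  ∃ (η : Path p p) (g : Germ (𝓝[S] p) ℂ),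
    IsSimpleLoopAround Y P η ∧ IsContinuation S η f g ∧ d = f - g

/-- `d = (1 - 𝓜_A) (1 - 𝓜_B) f`, the monodromies being taken inside `Z \ (A ∪ B)`. -/
def IsSequentialDiscontinuity (S Z A B : Set E) {p : E} (f d : Germ (𝓝[S] p) ℂ) : Prop :=
  ∃ u, IsDiscontinuity S (Z \ A) B f u ∧ IsDiscontinuity S (Z \ B) A u d

end Continuation

/-- Real momenta as complex momenta. -/
def complexify {X : Type} {s : ℕ} (p : X → Fin (s + 1) → ℝ) : X → Fin (s + 1) → ℂ :=
  fun x i => (p x i : ℂ)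

/-- The germ `f` on `𝒮(G₀)` at `p` is a branch of the Feynman integral of `G`: it is obtained by
analytic continuation along a path in `𝒮(G₀)` from a holomorphic germ `f₀` at a point `p₀` of the
physical region (real, on shell, with nonvanishing energies, which are positive for some choice of
incoming and outgoing particles) that equals the Feynman integral at all real points near `p₀`. -/
def FeynmanGraph.IsBranch {X : Type} [Fintype X] (G : FeynmanGraph X) (s : ℕ)
    {p : X → Fin (s + 1) → ℂ} (f : Germ (𝓝[G.extOnShell s] p) ℂ) : Prop :=
  ∃ (p₀ : X → Fin (s + 1) → ℝ) (f₀ : (X → Fin (s + 1) → ℂ) → ℂ) (γ : Path (complexify p₀) p),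
    complexify p₀ ∈ G.extOnShell s ∧ (∀ x, p₀ x 0 ≠ 0) ∧
    HolomorphicAtOn (G.extOnShell s) f₀ (complexify p₀) ∧
    (∀ᶠ p' in 𝓝 p₀, complexify p' ∈ G.extOnShell s →
      G.HasFeynmanIntegral p' (f₀ (complexify p'))) ∧
    IsContinuation (G.extOnShell s) γ (f₀ : Germ (𝓝[G.extOnShell s] (complexify p₀)) ℂ) f

/-! The statement is local and topological. If `A` and `B` cross transversally in `S`, the implicit
function theorem yields coordinates near the crossing point in which `S` is a ball of `ℂᵃ × ℂᵇ × K`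
for the sup norm, `A` is the zero set of the first coordinate and `B` that of the second
(`IntersectTransversallyAt.exists_crossingChart`). The complement of `A ∪ B` is then a product of
two punctured balls and a ball.

A simple loop around `A` bounds a disc that avoids `B`. Its component in the first punctured ball is
therefore a meridian, and its component in the second is null-homotopic
(`CrossingChart.exists_meridian_of_isSimpleLoopAround`). All meridians with the same base point are
homotopic (`IsMeridian.homotopic`): for `k = 1` they lift along the exponential to paths with the
same end points, and for `k ≥ 2` the disc can be pushed off the origin, so they are trivial. Hence
simple loops around `A` are homotopic to each other, and loops around `A` commute with loops around
`B`, because they move in different factors of a product.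

The monodromy theorem (`AnalyticAlong.eq_of_homotopy`) turns these homotopies into equalities of
germs. If `f` continues to `gA`, to `gB`, and to `h` along both loops in succession, then both
sequential discontinuities equal `f - gA - gB + h`. -/

/-! ### Analytic continuation along curves in a normed space -/

section AnalyticAlong

variable {M : Type*} [NormedAddCommGroup M] [NormedSpace ℂ M]

/-- `F t` is a coherent family of functions, analytic at the points `γ t` of a curve. -/
def AnalyticAlong (F : unitInterval → M → ℂ) (γ : unitInterval → M) : Prop :=
  (∀ t, AnalyticAt ℂ (F t) (γ t)) ∧ ∀ t, ∀ᶠ u in 𝓝 t, F u =ᶠ[𝓝 (γ u)] F t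

theorem AnalyticOnNhd.eventuallyEq_of_convex {f g : M → ℂ} {s : Set M} (hs : Convex ℝ s)
    (hf : AnalyticOnNhd ℂ f s) (hg : AnalyticOnNhd ℂ g s) {x y : M} (hx : x ∈ s) (hy : s ∈ 𝓝 y)
    (h : f =ᶠ[𝓝 x] g) : f =ᶠ[𝓝 y] g := by
  have h1 := hf.eqOn_of_preconnected_of_eventuallyEq hg hs.isPreconnected hx h
  filter_upwards [hy] with z hz using h1 hz

/-- By the identity theorem on a small ball, agreement of germs is both an open and a closed
condition. Connectedness of the unit interval then propagates it along curves. -/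
theorem AnalyticAt.eventually_germ_eq_iff {f g : M → ℂ} {x : M} (hf : AnalyticAt ℂ f x)
    (hg : AnalyticAt ℂ g x) : ∀ᶠ y in 𝓝 x, (f =ᶠ[𝓝 y] g ↔ f =ᶠ[𝓝 x] g) := by
  obtain ⟨r, hr, h⟩ := Metric.eventually_nhds_iff_ball.1
    (hf.eventually_analyticAt.and hg.eventually_analyticAt)
  filter_upwards [Metric.ball_mem_nhds x hr] with y hy
  have h1 : AnalyticOnNhd ℂ f (Metric.ball x r) := fun z hz => (h z hz).1
  have h2 : AnalyticOnNhd ℂ g (Metric.ball x r) := fun z hz => (h z hz).2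
  exact ⟨fun e => h1.eventuallyEq_of_convex (convex_ball x r) h2 hy (Metric.ball_mem_nhds x hr) e,
    fun e => h1.eventuallyEq_of_convex (convex_ball x r) h2 (Metric.mem_ball_self hr)
      (Metric.isOpen_ball.mem_nhds hy) e⟩

theorem eq_of_eventually_iff {P : unitInterval → Prop} (h : ∀ t, ∀ᶠ u in 𝓝 t, (P u ↔ P t))
    (s t : unitInterval) : P s ↔ P t := by
  have : IsLocallyConstant P :=
    (IsLocallyConstant.iff_eventually_eq P).2 fun t => (h t).mono fun u hu => propext hu
  exact iff_of_eq (this.apply_eq_of_preconnectedSpace s t)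

theorem AnalyticAlong.unique {F F' : unitInterval → M → ℂ} {γ : unitInterval → M}
    (hF : AnalyticAlong F γ) (hF' : AnalyticAlong F' γ) (hγ : Continuous γ)
    (h0 : F 0 =ᶠ[𝓝 (γ 0)] F' 0) (t : unitInterval) : F t =ᶠ[𝓝 (γ t)] F' t := by
  refine (eq_of_eventually_iff (P := fun t => F t =ᶠ[𝓝 (γ t)] F' t) (fun t => ?_) 0 t).1 h0
  filter_upwards [hF.2 t, hF'.2 t,
    hγ.continuousAt.eventually ((hF.1 t).eventually_germ_eq_iff (hF'.1 t))] with u h1 h2 h3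
  rw [← h3]
  exact ⟨fun h => (h1.symm.trans h).trans h2, fun h => (h1.trans h).trans h2.symm⟩

/-- The germs of a coherent family extend to balls of a uniform radius. -/
theorem AnalyticAlong.exists_uniform_radius {F : unitInterval → M → ℂ} {γ : unitInterval → M}
    (hF : AnalyticAlong F γ) (hγ : Continuous γ) :
    ∃ ρ > 0, ∃ G : unitInterval → M → ℂ, (∀ t, AnalyticOnNhd ℂ (G t) (Metric.ball (γ t) ρ)) ∧
      ∀ t, G t =ᶠ[𝓝 (γ t)] F t := by
  have key : ∃ ρ > 0, ∀ t ∈ (Set.univ : Set unitInterval), ∃ g : M → ℂ,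
      AnalyticOnNhd ℂ g (Metric.ball (γ t) ρ) ∧ g =ᶠ[𝓝 (γ t)] F t := by
    refine isCompact_univ.induction_on (p := fun s : Set unitInterval => ∃ ρ > 0, ∀ t ∈ s,
      ∃ g : M → ℂ, AnalyticOnNhd ℂ g (Metric.ball (γ t) ρ) ∧ g =ᶠ[𝓝 (γ t)] F t) ?_ ?_ ?_ ?_
    · exact ⟨1, one_pos, by simp⟩
    · rintro s t hst ⟨ρ, hρ, h⟩
      exact ⟨ρ, hρ, fun u hu => h u (hst hu)⟩
    · rintro s t ⟨ρ, hρ, h⟩ ⟨ρ', hρ', h'⟩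
      refine ⟨min ρ ρ', lt_min hρ hρ', ?_⟩
      rintro u (hu | hu)
      · obtain ⟨g, hg, hg'⟩ := h u hu
        exact ⟨g, hg.mono (Metric.ball_subset_ball (min_le_left _ _)), hg'⟩
      · obtain ⟨g, hg, hg'⟩ := h' u hu
        exact ⟨g, hg.mono (Metric.ball_subset_ball (min_le_right _ _)), hg'⟩
    · intro t _
      -- Half the radius of analyticity at `γ t` serves for all nearby `γ u`: their balls stay
      -- inside the ball of radius `r` around `γ t`.
      obtain ⟨r, hr, h⟩ := Metric.eventually_nhds_iff_ball.1 (hF.1 t).eventually_analyticAt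
      refine ⟨_, mem_nhdsWithin_of_mem_nhds ((hF.2 t).and (hγ.continuousAt.eventually
        (Metric.ball_mem_nhds (γ t) (half_pos hr)))), r / 2, half_pos hr, ?_⟩
      rintro u ⟨hu, hu'⟩
      refine ⟨F t, fun z hz => h z ?_, hu.symm⟩
      have := dist_triangle z (γ u) (γ t)
      rw [Metric.mem_ball] at *
      linarith
  obtain ⟨ρ, hρ, h⟩ := key
  choose G hG using fun t => h t trivial
  exact ⟨ρ, hρ, G, fun t => (hG t).1, fun t => (hG t).2⟩

/-- The germs on `γ` continue to a uniformly close curve. Coherence passes from `γ u` to `γ' u`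
because both lie in the intersection of the balls around `γ u` and `γ t`, which is convex. -/
theorem AnalyticAlong.of_near {F G : unitInterval → M → ℂ} {γ γ' : unitInterval → M} {ρ : ℝ}
    (hF : AnalyticAlong F γ) (hγ : Continuous γ)
    (hG : ∀ t, AnalyticOnNhd ℂ (G t) (Metric.ball (γ t) ρ)) (hGF : ∀ t, G t =ᶠ[𝓝 (γ t)] F t)
    (hγ' : Continuous γ') (hnear : ∀ t, dist (γ' t) (γ t) < ρ) : AnalyticAlong G γ' := by
  refine ⟨fun t => hG t _ (hnear t), fun t => ?_⟩
  have hρ : 0 < ρ := dist_nonneg.trans_lt (hnear t)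
  filter_upwards [hF.2 t, hγ.continuousAt.eventually (Metric.ball_mem_nhds (γ t) hρ),
    hγ.continuousAt.eventually (hGF t).eventually_nhds,
    hγ'.continuousAt.eventually (Metric.isOpen_ball.mem_nhds (hnear t))] with u h1 h2 h3 h4
  have h5 : G u =ᶠ[𝓝 (γ u)] G t := ((hGF u).trans h1).trans (EventuallyEq.symm h3)
  exact AnalyticOnNhd.eventuallyEq_of_convex ((convex_ball (γ u) ρ).inter (convex_ball (γ t) ρ))
    ((hG u).mono Set.inter_subset_left) ((hG t).mono Set.inter_subset_right)
    ⟨Metric.mem_ball_self hρ, h2⟩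
    (inter_mem (Metric.isOpen_ball.mem_nhds (hnear u)) (Metric.isOpen_ball.mem_nhds h4)) h5

/-- The monodromy theorem: analytic continuations along homotopic curves agree. -/
theorem AnalyticAlong.eq_of_homotopy {H : unitInterval × unitInterval → M} (hH : Continuous H)
    {F : unitInterval → unitInterval → M → ℂ}
    (hF : ∀ s, AnalyticAlong (F s) fun t => H (s, t)) {x y : M} (hx : ∀ s, H (s, 0) = x)
    (hy : ∀ s, H (s, 1) = y) (h0 : ∀ s s', F s 0 =ᶠ[𝓝 x] F s' 0) (s s' : unitInterval) :
    F s 1 =ᶠ[𝓝 y] F s' 1 := by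
  have hc : ∀ s, Continuous fun t => H (s, t) := fun s => by fun_prop
  refine (eq_of_eventually_iff (P := fun s => F s 1 =ᶠ[𝓝 y] F s' 1) (fun s => ?_) s' s).1
    (EventuallyEq.refl _ _)
  -- The final germ is locally constant in `s`: by compactness the curves with parameter near `s`
  -- stay within `ρ` of the curve at `s`, so its extended germs serve for them too.
  obtain ⟨ρ, hρ, G, hG, hGF⟩ := (hF s).exists_uniform_radius (hc s)
  have hnear : ∀ᶠ u in 𝓝 s, ∀ t ∈ (Set.univ : Set unitInterval),
      dist (H (u, t)) (H (s, t)) < ρ := by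
    refine isCompact_univ.eventually_forall_of_forall_eventually fun t _ => ?_
    have : Continuous fun z : unitInterval × unitInterval => dist (H z) (H (s, z.2)) := by fun_prop
    exact this.continuousAt.eventually_lt continuousAt_const (by simpa using hρ)
  filter_upwards [hnear] with u hu
  have h1 : AnalyticAlong G fun t => H (u, t) :=
    (hF s).of_near (hc s) hG hGF (hc u) fun t => hu t trivial
  have h2 := (hF u).unique h1 (hc u) (by
    have := hGF 0
    simp only [hx] at this ⊢
    exact (h0 u s).trans this.symm) 1
  have h3 := hGF 1
  simp only [hy] at h2 h3
  have h4 := h2.trans h3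
  exact ⟨fun h => h4.symm.trans h, fun h => h4.trans h⟩

end AnalyticAlong

/-! ### Operations on continuations -/

section Continuation

variable {E : Type*} [NormedAddCommGroup E] [NormedSpace ℂ E] {S : Set E}

theorem HolomorphicAtOn.sub {f g : E → ℂ} {x : E} (hf : HolomorphicAtOn S f x)
    (hg : HolomorphicAtOn S g x) : HolomorphicAtOn S (f - g) x := by
  obtain ⟨a, ha, ha'⟩ := hf
  obtain ⟨b, hb, hb'⟩ := hg
  exact ⟨a - b, ha.sub hb, ha'.sub hb'⟩

theorem IsContinuation.sub {p q : E} {γ : Path p q} {f f' : Germ (𝓝[S] p) ℂ}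
    {g g' : Germ (𝓝[S] q) ℂ} (h : IsContinuation S γ f g) (h' : IsContinuation S γ f' g') :
    IsContinuation S γ (f - f') (g - g') := by
  obtain ⟨hS, F, h1, h2, rfl, rfl⟩ := h
  obtain ⟨-, F', h1', h2', rfl, rfl⟩ := h'
  refine ⟨hS, fun t => F t - F' t, fun t => (h1 t).sub (h1' t), fun t => ?_, rfl, rfl⟩
  filter_upwards [h2 t, h2' t] with u hu hu' using hu.sub hu'

theorem IsContinuation.exists_of_trans {p q r : E} {γ : Path p q} {γ' : Path q r}
    {f : Germ (𝓝[S] p) ℂ} {h : Germ (𝓝[S] r) ℂ} (hc : IsContinuation S (γ.trans γ') f h) :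
    ∃ g, IsContinuation S γ f g ∧ IsContinuation S γ' g h := by
  obtain ⟨hS, F, h1, h2, rfl, rfl⟩ := hc
  have e1 : ∀ t : unitInterval, (t : ℝ) / 2 ∈ unitInterval := fun t =>
    ⟨by linarith [t.2.1], by linarith [t.2.2]⟩
  have e2 : ∀ t : unitInterval, ((t : ℝ) + 1) / 2 ∈ unitInterval := fun t =>
    ⟨by linarith [t.2.1], by linarith [t.2.2]⟩
  let a : unitInterval → unitInterval := fun t => ⟨t / 2, e1 t⟩
  let b : unitInterval → unitInterval := fun t => ⟨(t + 1) / 2, e2 t⟩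
  have ha : Continuous a := by fun_prop
  have hb : Continuous b := by fun_prop
  have ga : ∀ t, γ.trans γ' (a t) = γ t := fun t => by
    rw [Path.trans_apply, dif_pos (by simp only [a]; linarith [t.2.2])]
    congr 1; ext; simp only [a]; ring
  have gb : ∀ t, γ.trans γ' (b t) = γ' t := fun t => by
    rw [Path.trans_apply]
    split_ifs with ht
    -- The second half meets the first branch of `Path.trans` only at the junction, where both
    -- branches give `q`.
    · have : t = 0 := by exact le_antisymm (Subtype.coe_le_coe.1 (by simp only [b] at ht; simp; linarith)) t.2.1
      subst this
      simp [b]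
    · congr 1; ext; simp only [b]; ring
  have a0 : a 0 = 0 := by ext; simp [a]
  have b1 : b 1 = 1 := by ext; simp only [b]; norm_num
  have ab : a 1 = b 0 := by ext; simp [a, b]
  refine ⟨(F (a 1) : Germ (𝓝[S] q) ℂ), ⟨fun t => ga t ▸ hS _, fun t => F (a t),
    fun t => by simpa only [ga] using h1 (a t), fun t => ?_, by simp only [a0], rfl⟩,
    ⟨fun t => gb t ▸ hS _, fun t => F (b t),
    fun t => by simpa only [gb] using h1 (b t), fun t => ?_, by simp only [ab], by simp only [b1]⟩⟩
  · simpa only [ga] using ha.continuousAt.eventually (h2 (a t))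
  · simpa only [gb] using hb.continuousAt.eventually (h2 (b t))

end Continuation

/-! ### Loops in a punctured ball -/

section PuncturedBall

theorem norm_exp_two_pi_mul (t : ℝ) : ‖Complex.exp (2 * Real.pi * Complex.I * t)‖ = 1 := by
  rw [show (2 * Real.pi * Complex.I * t : ℂ) = ((2 * Real.pi * t : ℝ) : ℂ) * Complex.I by
    push_cast; ring]
  exact Complex.norm_exp_ofReal_mul_I _

theorem Convex.path_homotopic {V : Type*} [NormedAddCommGroup V] [NormedSpace ℝ V] {s : Set V}
    (hs : Convex ℝ s) {x y : s} (γ γ' : Path x y) : γ.Homotopic γ' := by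
  have := hs.contractibleSpace ⟨x, x.2⟩
  exact SimplyConnectedSpace.paths_homotopic γ γ'

/-- A loop which runs around the boundary of a disc in the space is null-homotopic. -/
theorem Path.homotopic_refl_of_disc {X : Type*} [TopologicalSpace X] {x y : X} (γ : Path x y)
    (c : Path y y) (g : C(Metric.closedBall (0 : ℂ) 1, X))
    (hc : ∀ t : unitInterval, ∀ h, c t = g ⟨Complex.exp (2 * Real.pi * Complex.I * (t : ℝ)), h⟩) :
    ((γ.trans c).trans γ.symm).Homotopic (Path.refl x) := by
  have hm : ∀ t : unitInterval, Complex.exp (2 * Real.pi * Complex.I * (t : ℝ)) ∈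
      Metric.closedBall (0 : ℂ) 1 := fun t => by simp [norm_exp_two_pi_mul]
  let b : Metric.closedBall (0 : ℂ) 1 := ⟨1, by simp⟩
  have hb1 : Complex.exp (2 * Real.pi * Complex.I * ((1 : unitInterval) : ℝ)) = 1 := by simp
  let e : Path b b :=
    { toFun := fun t => ⟨_, hm t⟩
      continuous_toFun := by fun_prop
      source' := by ext; simp [b]
      target' := by ext; simp [b] }
  have hy : y = g b := by
    have := hc 0 (hm 0)
    rw [c.source] at this
    rw [this]; congr 1; ext; simp [b]
  have h1 : c.Homotopic (Path.refl y) := by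
    have h2 := (((convex_closedBall (0 : ℂ) 1).path_homotopic e (Path.refl b)).map g).pathCast hy hy
    have h3 : (e.map g.continuous).cast hy hy = c := by
      ext t; simp [e, hc t (hm t)]
    have h4 : ((Path.refl b).map g.continuous).cast hy hy = Path.refl y := by
      ext t; simp [hy]
    rwa [h3, h4] at h2
  have h5 : (γ.trans c).Homotopic γ :=
    ((Path.Homotopic.refl γ).hcomp h1).trans ⟨Path.Homotopy.transRefl γ⟩
  exact (h5.hcomp (Path.Homotopic.refl γ.symm)).trans ⟨(Path.Homotopy.reflTransSymm γ).symm⟩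

/-- The punctured open ball of radius `r` in `ℂᵏ`. -/
abbrev PuncturedBall (k : ℕ) (r : ℝ) : Set (Fin k → ℂ) := Metric.ball 0 r \ {0}

/-- A loop in the punctured ball that goes once around the boundary of a holomorphic disc which
passes through the origin at its centre, is immersed there, and avoids the origin elsewhere. -/
def IsMeridian {k : ℕ} {r : ℝ} {x : PuncturedBall k r} (η : Path x x) : Prop :=
  ∃ (φ : ℂ → Fin k → ℂ) (y : PuncturedBall k r) (γ : Path x y) (c : Path y y),
    AnalyticOnNhd ℂ φ (Metric.closedBall 0 1) ∧ φ 0 = 0 ∧ deriv φ 0 ≠ 0 ∧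
    (∀ z : ℂ, ‖z‖ ≤ 1 → ‖φ z‖ < r) ∧ (∀ z : ℂ, ‖z‖ ≤ 1 → z ≠ 0 → φ z ≠ 0) ∧
    (∀ t : unitInterval, (c t : Fin k → ℂ) = φ (Complex.exp (2 * Real.pi * Complex.I * (t : ℝ)))) ∧
    η = (γ.trans c).trans γ.symm

/-- General position: the disc has real dimension 2, less than `2k`, so a small perturbation fixed
on the boundary moves it off the origin, and the loop then bounds a disc in the punctured ball. -/
theorem IsMeridian.homotopic_refl {k : ℕ} (hk : 2 ≤ k) {r : ℝ} {x : PuncturedBall k r}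
    {η : Path x x} (h : IsMeridian η) : η.Homotopic (Path.refl x) := by
  obtain ⟨φ, y, γ, c, hφ, -, -, hr, hne, hc, rfl⟩ := h
  have hcont : ContinuousOn φ (Metric.closedBall 0 1) := hφ.continuousOn
  obtain ⟨z₀, hz₀, hmax⟩ := (isCompact_closedBall (0 : ℂ) 1).exists_isMaxOn
    ⟨0, by simp⟩ hcont.norm
  have hz₀r : ‖φ z₀‖ < r := hr z₀ (by simpa using hz₀)
  -- The perturbed disc `φ z - (1 - ‖z‖²) v` vanishes at an interior `z` exactly when `v` lies in
  -- this image. A smooth image of too small a dimension has dense complement.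
  have hdense : Dense ((fun z : ℂ => (1 - ‖z‖ ^ 2)⁻¹ • φ z) '' Metric.ball 0 1)ᶜ := by
    refine ContDiffOn.dense_compl_image_of_dimH_lt_finrank (s := Metric.ball 0 1) ?_
      (convex_ball _ _) subset_rfl ?_
    · refine ContDiffOn.smul (ContDiffOn.inv
        (contDiff_const.sub (contDiff_norm_sq ℝ)).contDiffOn fun z hz => ?_) ?_
      · have : ‖z‖ < 1 := by simpa using hz
        nlinarith [norm_nonneg z]
      · have : AnalyticOnNhd ℝ φ (Metric.ball 0 1) :=
          fun z hz => (hφ z (Metric.ball_subset_closedBall hz)).restrictScalars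
        exact this.contDiffOn Metric.isOpen_ball.uniqueDiffOn
    · rw [Real.dimH_of_mem_nhds (Metric.ball_mem_nhds (0 : ℂ) one_pos), Complex.finrank_real_complex,
        Module.finrank_pi_fintype]
      simp only [Complex.finrank_real_complex, Finset.sum_const, Finset.card_univ,
        Fintype.card_fin, smul_eq_mul]
      exact_mod_cast (by omega : 2 < k * 2)
  -- With `v` shorter than the gap between `r` and the maximum of `‖φ‖`, the perturbed disc stays in
  -- the ball.
  obtain ⟨v, hv, hvr⟩ := hdense.exists_dist_lt (0 : Fin k → ℂ) (sub_pos.2 hz₀r)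
  rw [dist_zero_left] at hvr
  let ψ : ℂ → Fin k → ℂ := fun z => φ z - (1 - ‖z‖ ^ 2 : ℝ) • v
  have hψ : ∀ z ∈ Metric.closedBall (0 : ℂ) 1, ψ z ∈ PuncturedBall k r := by
    intro z hz
    have hz1 : ‖z‖ ≤ 1 := by simpa using hz
    refine ⟨?_, fun h0 => ?_⟩
    · have h1 : ‖φ z‖ ≤ ‖φ z₀‖ := hmax hz
      have h2 : ‖(1 - ‖z‖ ^ 2 : ℝ) • v‖ ≤ ‖v‖ := by
        rw [norm_smul, Real.norm_of_nonneg (by nlinarith [norm_nonneg z])]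
        nlinarith [norm_nonneg v, mul_nonneg (sq_nonneg ‖z‖) (norm_nonneg v)]
      have := norm_sub_le (φ z) ((1 - ‖z‖ ^ 2 : ℝ) • v)
      simp only [Metric.mem_ball, dist_zero_right, ψ]
      linarith
    · have h0 : φ z = (1 - ‖z‖ ^ 2 : ℝ) • v := sub_eq_zero.1 h0
      rcases hz1.lt_or_eq with h1 | h1
      · refine hv ⟨z, by simpa using h1, ?_⟩
        simp only [h0]
        exact inv_smul_smul₀ (by nlinarith [norm_nonneg z]) v
      · refine hne z hz1 (fun h => by simp [h] at h1) ?_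
        rw [h0, h1]; simp
  refine Path.homotopic_refl_of_disc γ c ⟨fun z => ⟨ψ z, hψ z z.2⟩, ?_⟩ fun t h => ?_
  · refine Continuous.subtype_mk ?_ _
    have h1 : Continuous fun z : Metric.closedBall (0 : ℂ) 1 => φ z :=
      continuousOn_iff_continuous_domRestrict.1 hcont
    exact h1.sub (by fun_prop)
  · ext1
    simp only [ContinuousMap.coe_mk, hc, ψ, norm_exp_two_pi_mul]
    simp

/-- A continuous nonvanishing function on a convex set has a continuous logarithm. -/
theorem Convex.exists_continuous_log {V : Type*} [NormedAddCommGroup V] [NormedSpace ℝ V]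
    {s : Set V} (hs : Convex ℝ s) (a : s) (f : C(s, ℂ)) (hf : ∀ z, f z ≠ 0) {w : ℂ}
    (hw : Complex.exp w = f a) : ∃ l : C(s, ℂ), l a = w ∧ ∀ z, Complex.exp (l z) = f z := by
  have := hs.contractibleSpace ⟨a, a.2⟩
  have := hs.locallyPathConnectedSpace
  obtain ⟨l, ⟨h1, h2⟩, -⟩ := Complex.isCoveringMapOn_exp.existsUnique_continuousMap_lifts f hw hf
  exact ⟨l, h1, fun z => congrFun h2 z⟩

/-- A meridian of the punctured disc lifts along the exponential to a path which ends at the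
translate by `2πi` of its starting point. -/
theorem IsMeridian.exists_lift {r : ℝ} {x : PuncturedBall 1 r} {η : Path x x} (h : IsMeridian η)
    {w : ℂ} (hw : Complex.exp w = x.1 0) :
    ∃ Λ : Path w (w + 2 * Real.pi * Complex.I), ∀ t, Complex.exp (Λ t) = (η t).1 0 := by
  obtain ⟨φ, y, γ, c, hφ, h0, hd, hr, hne, hc, rfl⟩ := h
  have hne0 : ∀ u : PuncturedBall 1 r, u.1 0 ≠ 0 := fun u h =>
    u.2.2 (funext fun i => by rw [Subsingleton.elim i 0, h]; rfl)
  have hφ0 : ∀ z ∈ Metric.closedBall (0 : ℂ) 1, AnalyticAt ℂ (fun z => φ z 0) z := fun z hz =>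
    (analyticAt_pi_iff.1 (hφ z hz)) 0
  obtain ⟨l, hl0, hl⟩ := (convex_Icc (0 : ℝ) 1).exists_continuous_log 0
    (⟨fun t => (γ t).1 0,
      (continuous_apply 0).comp (continuous_subtype_val.comp γ.continuous)⟩ : C(Set.Icc (0 : ℝ) 1, ℂ)) (fun t => hne0 _) (w := w)
    (by simpa using hw)
  have hl1 : Complex.exp (l 1) = y.1 0 := by simpa using hl 1
  -- Write `φ z = z h(z)`. The immersion condition at the centre gives `h 0 ≠ 0`, so `h` has a
  -- logarithm on the whole disc. The increment `2πi` along the circle comes from the factor `z`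
  -- alone.
  let h : ℂ → ℂ := dslope (fun z => φ z 0) 0
  have hh : ∀ z, φ z 0 = z * h z := fun z => by
    have := sub_smul_dslope (fun z => φ z 0) 0 z
    simp only [sub_zero, smul_eq_mul, h0, Pi.zero_apply] at this
    exact this.symm
  have hhc : ContinuousOn h (Metric.closedBall 0 1) :=
    (continuousOn_dslope (Metric.closedBall_mem_nhds _ one_pos)).2
      ⟨fun z hz => (hφ0 z hz).continuousAt.continuousWithinAt,
        (hφ0 0 (by simp)).differentiableAt⟩
  have hhne : ∀ z ∈ Metric.closedBall (0 : ℂ) 1, h z ≠ 0 := by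
    intro z hz hz0
    by_cases hzz : z = 0
    · subst hzz
      refine hd (funext fun i => ?_)
      have h1 : deriv (fun z => φ z 0) 0 = deriv φ 0 0 := by
        have := (hasDerivAt_pi.1 (hφ 0 (by simp)).differentiableAt.hasDerivAt) 0
        exact this.deriv
      rw [Subsingleton.elim i 0, ← h1]
      simpa [h, dslope_same] using hz0
    · refine hne z (by simpa using hz) hzz (funext fun i => ?_)
      rw [Subsingleton.elim i 0, hh z, hz0]; simp
  have hy : y.1 0 = h 1 := by
    have h1 := congrFun (hc 0) 0
    simp only [c.source] at h1
    rw [h1]; simp [hh]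
  obtain ⟨m, hm0, hm⟩ := (convex_closedBall (0 : ℂ) 1).exists_continuous_log ⟨1, by simp⟩
    (⟨_, continuousOn_iff_continuous_domRestrict.1 hhc⟩ : C(Metric.closedBall (0 : ℂ) 1, ℂ))
    (fun z => hhne z z.2) (w := l 1) (by rw [hl1, hy]; rfl)
  have hmem : ∀ t : unitInterval, Complex.exp (2 * Real.pi * Complex.I * (t : ℝ)) ∈
      Metric.closedBall (0 : ℂ) 1 := fun t => by simp [norm_exp_two_pi_mul]
  let γ' : Path w (l 1) := ⟨⟨fun t => l t, by fun_prop⟩, hl0, rfl⟩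
  let c' : Path (l 1) (l 1 + 2 * Real.pi * Complex.I) :=
    { toFun := fun t => m ⟨_, hmem t⟩ + 2 * Real.pi * Complex.I * (t : ℝ)
      continuous_toFun := by fun_prop
      source' := by rw [← hm0]; simp
      target' := by rw [← hm0]; simp }
  -- The way back is the outward lift, reversed and shifted by `2πi`.
  let δ : Path (l 1 + 2 * Real.pi * Complex.I) (w + 2 * Real.pi * Complex.I) :=
    (γ'.map (f := fun z => z + 2 * Real.pi * Complex.I) (by fun_prop)).symm
  have e1 : ∀ t, Complex.exp (γ' t) = (γ t).1 0 := hl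
  have e2 : ∀ t, Complex.exp (c' t) = (c t).1 0 := fun t => by
    have := hm ⟨_, hmem t⟩
    simp only [c', Path.coe_mk_mk, Complex.exp_add, this, hc, hh]
    simp [mul_comm]
  have e3 : ∀ t, Complex.exp (δ t) = (γ.symm t).1 0 := fun t => by
    simp [δ, Complex.exp_add, Complex.exp_two_pi_mul_I, e1]
  refine ⟨(γ'.trans c').trans δ, fun t => ?_⟩
  simp only [Path.trans_apply]
  split_ifs <;> simp [e1, e2, e3]

/-- Any two meridians in a punctured ball are homotopic. -/
theorem IsMeridian.homotopic {k : ℕ} {r : ℝ} {x : PuncturedBall k r} {η η' : Path x x}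
    (h : IsMeridian η) (h' : IsMeridian η') : η.Homotopic η' := by
  match k, x, η, η', h, h' with
  | 0, x, _, _, _, _ => exact absurd (Subsingleton.elim _ _) x.2.2
  | k + 2, x, η, η', h, h' =>
    exact (h.homotopic_refl (by omega)).trans (h'.homotopic_refl (by omega)).symm
  | 1, x, η, η', h, h' =>
    have hx : x.1 0 ≠ 0 := fun h =>
      x.2.2 (funext fun i => by rw [Subsingleton.elim i 0, h]; rfl)
    obtain ⟨w, hw⟩ : ∃ w, Complex.exp w = x.1 0 := ⟨_, Complex.exp_log hx⟩
    obtain ⟨Λ, hΛ⟩ := h.exists_lift hw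
    obtain ⟨Λ', hΛ'⟩ := h'.exists_lift hw
    have hr : 0 < r := by
      have := x.2.1
      rw [Metric.mem_ball] at this
      exact dist_nonneg.trans_lt this
    -- The exponential maps this half-plane onto the punctured disc. Lifts with common end points
    -- are homotopic in it by convexity, and the homotopy is pushed down.
    let P : Set ℂ := {w | w.re < Real.log r}
    have hP : Convex ℝ P := convex_halfSpace_re_lt _
    have mem_iff : ∀ w : ℂ, (fun _ => Complex.exp w) ∈ PuncturedBall 1 r ↔ w ∈ P := fun w => by
      have : (fun _ : Fin 1 => Complex.exp w) ≠ 0 := fun h => Complex.exp_ne_zero w (congrFun h 0)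
      simp [PuncturedBall, this, pi_norm_const, Complex.norm_exp, P, Real.lt_log_iff_exp_lt hr]
    have mem_of : ∀ (u : PuncturedBall 1 r) (w : ℂ), Complex.exp w = u.1 0 → w ∈ P := fun u w h =>
      (mem_iff w).1 (by
        convert u.2 using 1
        funext i
        rw [Subsingleton.elim i 0, h])
    let e : C(P, PuncturedBall 1 r) := ⟨fun w => ⟨fun _ => Complex.exp w, (mem_iff w).2 w.2⟩, by
      fun_prop⟩
    have hw' : Complex.exp (w + 2 * Real.pi * Complex.I) = x.1 0 := by
      rw [Complex.exp_add, Complex.exp_two_pi_mul_I, hw, mul_one]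
    have he : ∀ (u : PuncturedBall 1 r) (w : P), Complex.exp w = u.1 0 → u = e w := fun u w h => by
      ext i
      rw [Subsingleton.elim i 0]
      exact h.symm
    let lift : ∀ (ζ : Path x x) (Λ : Path w (w + 2 * Real.pi * Complex.I)),
        (∀ t, Complex.exp (Λ t) = (ζ t).1 0) →
        Path (⟨w, mem_of x w hw⟩ : P) ⟨w + 2 * Real.pi * Complex.I, mem_of x _ hw'⟩ :=
      fun ζ Λ hΛ =>
      { toFun := fun t => ⟨Λ t, mem_of _ _ (hΛ t)⟩
        continuous_toFun := by fun_prop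
        source' := by ext; simp
        target' := by ext; simp }
    have key := ((hP.path_homotopic (lift η Λ hΛ) (lift η' Λ' hΛ')).map e).pathCast
      (he x _ hw) (he x _ hw')
    have hcast : ∀ (ζ : Path x x) (Λ) (hΛ), ((lift ζ Λ hΛ).map e.continuous).cast
        (he x _ hw) (he x _ hw') = ζ := fun ζ Λ hΛ => by
      refine Path.ext (funext fun t => ?_)
      exact (he (ζ t) ⟨Λ t, mem_of _ _ (hΛ t)⟩ (hΛ t)).symm
    rwa [hcast η Λ hΛ, hcast η' Λ' hΛ'] at key

end PuncturedBall

/-! ### Charts adapted to a transversal intersection -/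

section Tangent

variable {E : Type*} [NormedAddCommGroup E] [NormedSpace ℂ E]

/-- Along `M` the function has derivative zero, and a derivative within a set is unique on its
tangent cone. Only this inclusion of the tangent space in the kernel is needed, not equality. -/
theorem fderiv_eq_zero_of_mem_tangentSpaceAt {G : Type*} [NormedAddCommGroup G] [NormedSpace ℂ G]
    {M : Set E} {x : E} {F : E → G} (hF : DifferentiableAt ℂ F x) (hx : x ∈ M)
    (h : ∀ᶠ y in 𝓝 x, y ∈ M → F y = 0) {v : E} (hv : v ∈ tangentSpaceAt M x) :
    fderiv ℂ F x v = 0 := by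
  have h0 : HasFDerivWithinAt F (0 : E →L[ℂ] G) M x :=
    (hasFDerivWithinAt_const (0 : G) x M).congr_of_eventuallyEq
      (eventually_nhdsWithin_iff.2 h) (h.self_of_nhds hx)
  have h1 : tangentSpaceAt M x ≤ LinearMap.ker (fderiv ℂ F x : E →ₗ[ℂ] G) :=
    Submodule.span_le.2 fun w hw => by
      simpa using hF.hasFDerivAt.hasFDerivWithinAt.unique_on h0 hw
  simpa using h1 hv

theorem deriv_mem_tangentSpaceAt {M : Set E} {φ : ℂ → E} (hφ : DifferentiableAt ℂ φ 0)
    (h : ∀ᶠ z in 𝓝 (0 : ℂ), φ z ∈ M) : deriv φ 0 ∈ tangentSpaceAt M (φ 0) := by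
  have h1 := (hφ.hasDerivAt.hasFDerivAt.hasFDerivWithinAt (s := {z | φ z ∈ M})).mapsTo_tangent_cone
  rw [tangentConeAt_of_mem_nhds h] at h1
  have h2 := h1 (Set.mem_univ 1)
  refine Submodule.subset_span (tangentConeAt_mono ?_ (by simpa using h2))
  rintro _ ⟨z, hz, rfl⟩
  exact hz

end Tangent

theorem CrossingChart.mem_ball_iff {a b : ℕ} {K : Type*} [NormedAddCommGroup K]
    {z : (Fin a → ℂ) × (Fin b → ℂ) × K} {r : ℝ} : z ∈ Metric.ball 0 r ↔
    z.1 ∈ Metric.ball 0 r ∧ z.2.1 ∈ Metric.ball 0 r ∧ z.2.2 ∈ Metric.ball 0 r := by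
  simp [Prod.norm_def]

/-- A parametrization of the part of `S` in the open set `U` by a ball of `ℂᵃ × ℂᵇ × K`, for which
`A` and `B` are the sets where the first and the second coordinate vanish. -/
structure CrossingChart {E : Type*} [NormedAddCommGroup E] [NormedSpace ℂ E] (S A B U : Set E)
    (a b : ℕ) (K : Type*) [NormedAddCommGroup K] [NormedSpace ℂ K] where
  param : (Fin a → ℂ) × (Fin b → ℂ) × K → E
  coord : E → (Fin a → ℂ) × (Fin b → ℂ) × K
  r : ℝ
  isOpen : IsOpen U
  analyticOnNhd_param : AnalyticOnNhd ℂ param (Metric.ball 0 r)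
  analyticOnNhd_coord : AnalyticOnNhd ℂ coord U
  param_mem : ∀ z ∈ Metric.ball 0 r, param z ∈ U ∩ S
  coord_mem : ∀ x ∈ U ∩ S, coord x ∈ Metric.ball 0 r
  param_coord : ∀ x ∈ U ∩ S, param (coord x) = x
  coord_param : ∀ z ∈ Metric.ball 0 r, coord (param z) = z
  mem_left : ∀ x ∈ U, x ∈ A ↔ x ∈ S ∧ (coord x).1 = 0
  mem_right : ∀ x ∈ U, x ∈ B ↔ x ∈ S ∧ (coord x).2.1 = 0

namespace CrossingChart

variable {E : Type*} [NormedAddCommGroup E] [NormedSpace ℂ E] {S A B U : Set E}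
  {a b : ℕ} {K : Type*} [NormedAddCommGroup K] [NormedSpace ℂ K]

/-- Exchange the two submanifolds of a crossing chart. -/
def swap (C : CrossingChart S A B U a b K) : CrossingChart S B A U b a K where
  param z := C.param (z.2.1, z.1, z.2.2)
  coord x := ((C.coord x).2.1, (C.coord x).1, (C.coord x).2.2)
  r := C.r
  isOpen := C.isOpen
  analyticOnNhd_param z hz := by
    have h1 : AnalyticAt ℂ (fun z : (Fin b → ℂ) × (Fin a → ℂ) × K => (z.2.1, z.1, z.2.2)) z :=
      (analyticAt_fst.comp analyticAt_snd).prod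
        (analyticAt_fst.prod (analyticAt_snd.comp analyticAt_snd))
    refine (C.analyticOnNhd_param _ ?_).comp_of_eq h1 rfl
    simpa [Prod.norm_def, and_left_comm] using hz
  analyticOnNhd_coord x hx := by
    have h1 := C.analyticOnNhd_coord x hx
    exact (analyticAt_fst.comp_of_eq (analyticAt_snd.comp_of_eq h1 rfl) rfl).prod
      ((analyticAt_fst.comp_of_eq h1 rfl).prod
        (analyticAt_snd.comp_of_eq (analyticAt_snd.comp_of_eq h1 rfl) rfl))
  param_mem z hz := C.param_mem _ (by simpa [Prod.norm_def, and_left_comm] using hz)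
  coord_mem x hx := by simpa [Prod.norm_def, and_left_comm] using C.coord_mem x hx
  param_coord x hx := C.param_coord x hx
  coord_param z hz := by
    rw [C.coord_param _ (by simpa [Prod.norm_def, and_left_comm] using hz)]
  mem_left := C.mem_right
  mem_right := C.mem_left

variable (C : CrossingChart S A B U a b K)

/-- The product of two punctured balls and a ball. -/
abbrev Model : Type _ :=
  PuncturedBall a C.r × PuncturedBall b C.r × Metric.ball (0 : K) C.r

/-- The coordinates of a point of the model. -/
def val (t : C.Model) : (Fin a → ℂ) × (Fin b → ℂ) × K := (t.1, t.2.1, t.2.2)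

/-- The point of the manifold with the given coordinates. -/
def point (t : C.Model) : E := C.param (C.val t)

theorem val_mem (t : C.Model) : C.val t ∈ Metric.ball 0 C.r :=
  mem_ball_iff.2 ⟨t.1.2.1, t.2.1.2.1, t.2.2.2⟩

theorem continuous_val : Continuous C.val := by
  unfold val; fun_prop

theorem continuous_point : Continuous C.point :=
  C.analyticOnNhd_param.continuousOn.comp_continuous C.continuous_val C.val_mem

theorem coord_point (t : C.Model) : C.coord (C.point t) = C.val t :=
  C.coord_param _ (C.val_mem t)

theorem point_mem (t : C.Model) : C.point t ∈ (U ∩ S) \ (A ∪ B) := by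
  have h := C.param_mem _ (C.val_mem t)
  refine ⟨h, ?_⟩
  rintro (h1 | h1)
  · have := ((C.mem_left _ h.1).1 h1).2
    exact t.1.2.2 (by rwa [C.coord_param _ (C.val_mem t)] at this)
  · have := ((C.mem_right _ h.1).1 h1).2
    exact t.2.1.2.2 (by rwa [C.coord_param _ (C.val_mem t)] at this)

/-- The model point of a point outside the two submanifolds. -/
def toModel (x : E) (hx : x ∈ (U ∩ S) \ (A ∪ B)) : C.Model :=
  (⟨(C.coord x).1, (mem_ball_iff.1 (C.coord_mem x hx.1)).1,
      fun h => hx.2 (Or.inl ((C.mem_left x hx.1.1).2 ⟨hx.1.2, h⟩))⟩,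
    ⟨(C.coord x).2.1, (mem_ball_iff.1 (C.coord_mem x hx.1)).2.1,
      fun h => hx.2 (Or.inr ((C.mem_right x hx.1.1).2 ⟨hx.1.2, h⟩))⟩,
    ⟨(C.coord x).2.2, (mem_ball_iff.1 (C.coord_mem x hx.1)).2.2⟩)

theorem point_toModel (x : E) (hx : x ∈ (U ∩ S) \ (A ∪ B)) : C.point (C.toModel x hx) = x :=
  C.param_coord x hx.1

theorem toModel_point (t : C.Model) (h : C.point t ∈ (U ∩ S) \ (A ∪ B)) :
    C.toModel (C.point t) h = t := by
  have := C.coord_point t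
  ext <;> simp [toModel, this, val]

theorem exists_lift_path {x y : E} (γ : Path x y) (hγ : ∀ t, γ t ∈ (U ∩ S) \ (A ∪ B))
    {t₀ t₁ : C.Model} (h₀ : C.point t₀ = x) (h₁ : C.point t₁ = y) :
    ∃ γ' : Path t₀ t₁, ∀ t, C.point (γ' t) = γ t := by
  subst h₀ h₁
  have hc : Continuous fun t => C.coord (γ t) :=
    C.analyticOnNhd_coord.continuousOn.comp_continuous γ.continuous fun t => (hγ t).1.1
  refine ⟨⟨⟨fun t => C.toModel (γ t) (hγ t), ?_⟩, ?_, ?_⟩, fun t => C.point_toModel _ (hγ t)⟩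
  · unfold toModel
    fun_prop
  · simp only [γ.source, toModel_point]
  · simp only [γ.target, toModel_point]

/-- Since `coord` is a continuous inverse, germs of functions on `S` become ordinary germs on an
open set of the model, where the identity theorem applies. -/
theorem map_nhds {z : (Fin a → ℂ) × (Fin b → ℂ) × K} (hz : z ∈ Metric.ball 0 C.r) :
    map C.param (𝓝 z) = 𝓝[S] (C.param z) := by
  have hz' := C.param_mem z hz
  refine le_antisymm ?_ fun s hs => ?_
  · refine tendsto_nhdsWithin_iff.2 ⟨(C.analyticOnNhd_param z hz).continuousAt, ?_⟩
    filter_upwards [Metric.isOpen_ball.mem_nhds hz] with y hy using (C.param_mem y hy).2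
  · have h1 : C.coord ⁻¹' (C.param ⁻¹' s) ∈ 𝓝 (C.param z) :=
      (C.analyticOnNhd_coord _ hz'.1).continuousAt (by rwa [C.coord_param z hz])
    rw [mem_nhdsWithin_iff_exists_mem_nhds_inter]
    refine ⟨_, inter_mem h1 (C.isOpen.mem_nhds hz'.1), ?_⟩
    rintro y ⟨⟨h2, h3⟩, h4⟩
    simpa only [Set.mem_preimage, C.param_coord y ⟨h3, h4⟩] using h2

theorem eventuallyEq_iff (t : C.Model) {f g : E → ℂ} :
    f =ᶠ[𝓝[S] (C.point t)] g ↔ (f ∘ C.param) =ᶠ[𝓝 (C.val t)] (g ∘ C.param) := by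
  rw [point, ← C.map_nhds (C.val_mem t)]
  exact eventually_map

theorem exists_analyticAlong {t₀ t₁ : C.Model} {γ : Path t₀ t₁}
    {f : Germ (𝓝[S] (C.point t₀)) ℂ} {g : Germ (𝓝[S] (C.point t₁)) ℂ}
    (h : IsContinuation S (γ.map C.continuous_point) f g) :
    ∃ F : unitInterval → E → ℂ, AnalyticAlong (fun t => F t ∘ C.param) (fun t => C.val (γ t)) ∧
      (F 0 : Germ (𝓝[S] (C.point t₀)) ℂ) = f ∧ (F 1 : Germ (𝓝[S] (C.point t₁)) ℂ) = g := by
  obtain ⟨-, F, h1, h2, h3, h4⟩ := h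
  refine ⟨F, ⟨fun t => ?_, fun t => ?_⟩, h3, h4⟩
  · obtain ⟨k, hk, hk'⟩ := h1 t
    have h5 := (C.eventuallyEq_iff (γ t)).1 hk'
    refine AnalyticAt.congr ?_ h5.symm
    exact hk.comp_of_eq (C.analyticOnNhd_param _ (C.val_mem (γ t))) rfl
  · filter_upwards [h2 t] with u hu
    exact (C.eventuallyEq_iff (γ u)).1 hu

theorem continuation_unique {t₀ t₁ : C.Model} {γ : Path t₀ t₁}
    {f : Germ (𝓝[S] (C.point t₀)) ℂ} {g g' : Germ (𝓝[S] (C.point t₁)) ℂ}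
    (h : IsContinuation S (γ.map C.continuous_point) f g)
    (h' : IsContinuation S (γ.map C.continuous_point) f g') : g = g' := by
  obtain ⟨F, hF, rfl, rfl⟩ := C.exists_analyticAlong h
  obtain ⟨F', hF', h0, rfl⟩ := C.exists_analyticAlong h'
  refine Germ.coe_eq.2 ((C.eventuallyEq_iff t₁).2 ?_)
  have h1 := (C.eventuallyEq_iff t₀).1 (Germ.coe_eq.1 h0.symm)
  have h2 := hF.unique hF' (C.continuous_val.comp γ.continuous) (by simpa using h1) 1
  simpa using h2

/-- Continuability along every path in `Ω` supplies a continuation along each intermediate path of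
the homotopy, as the monodromy theorem requires. -/
theorem continuation_eq_of_homotopic {t₀ t₁ : C.Model} {γ γ' : Path t₀ t₁} (hγ : γ.Homotopic γ')
    {f : Germ (𝓝[S] (C.point t₀)) ℂ} {g g' : Germ (𝓝[S] (C.point t₁)) ℂ}
    (hf : ContinuesAlongPathsIn S ((U ∩ S) \ (A ∪ B)) f)
    (h : IsContinuation S (γ.map C.continuous_point) f g)
    (h' : IsContinuation S (γ'.map C.continuous_point) f g') : g = g' := by
  obtain ⟨H⟩ := hγ
  choose k hk using fun s => hf _ ((H.eval s).map C.continuous_point) fun t => C.point_mem _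
  choose F hF hF0 hF1 using fun s => C.exists_analyticAlong (hk s)
  have e0 : k 0 = g := C.continuation_unique (γ := γ) (by simpa using hk 0) h
  have e1 : k 1 = g' := C.continuation_unique (γ := γ') (by simpa using hk 1) h'
  rw [← e0, ← e1, ← hF1 0, ← hF1 1]
  refine Germ.coe_eq.2 ((C.eventuallyEq_iff t₁).2 ?_)
  refine AnalyticAlong.eq_of_homotopy (H := fun z => C.val (H z))
    (F := fun s t => F s t ∘ C.param) (C.continuous_val.comp H.continuous) hF
    (x := C.val t₀) (fun s => by simp) (fun s => by simp) (fun s s' => ?_) 0 1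
  exact (C.eventuallyEq_iff t₀).1 (Germ.coe_eq.1 ((hF0 s).trans (hF0 s').symm))

theorem homotopic_of_components {t₀ t₁ : C.Model} {γ γ' : Path t₀ t₁}
    (h1 : (γ.map continuous_fst).Homotopic (γ'.map continuous_fst))
    (h2 : (γ.map (continuous_fst.comp continuous_snd)).Homotopic
      (γ'.map (continuous_fst.comp continuous_snd))) : γ.Homotopic γ' := by
  obtain ⟨H1⟩ := h1
  obtain ⟨H2⟩ := h2
  obtain ⟨H3⟩ := (convex_ball (0 : K) C.r).path_homotopic
    (γ.map (continuous_snd.comp continuous_snd)) (γ'.map (continuous_snd.comp continuous_snd))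
  exact ⟨Path.Homotopic.prodHomotopy H1 (Path.Homotopic.prodHomotopy H2 H3)⟩

end CrossingChart

/-! ### Simple loops in a crossing chart -/

namespace CrossingChart

variable {E : Type*} [NormedAddCommGroup E] [NormedSpace ℂ E] {S A B U : Set E}
  {a b : ℕ} {K : Type*} [NormedAddCommGroup K] [NormedSpace ℂ K]
  (C : CrossingChart S A B U a b K)

/-- If this derivative vanished, the straight line in the chart with the velocity of the disc would
stay in `A` near the centre. The velocity of `φ` would then be tangent to `A`. -/
theorem deriv_coord_fst_ne_zero {φ : ℂ → E} (hφ : DifferentiableAt ℂ φ 0)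
    (hmem : ∀ᶠ z in 𝓝 (0 : ℂ), φ z ∈ U ∩ S) (h0 : φ 0 ∈ A)
    (hd : deriv φ 0 ∉ tangentSpaceAt A (φ 0)) : deriv (fun z => (C.coord (φ z)).1) 0 ≠ 0 := by
  intro hz
  have hx : φ 0 ∈ U ∩ S := hmem.self_of_nhds
  have hb := C.coord_mem _ hx
  have hw : HasDerivAt (fun z => C.coord (φ z)) (deriv (fun z => C.coord (φ z)) 0) 0 :=
    ((C.analyticOnNhd_coord _ hx.1).differentiableAt.comp (0 : ℂ) hφ).hasDerivAt
  set w' := deriv (fun z => C.coord (φ z)) 0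
  have hw1 : w'.1 = 0 := by
    rw [← hz]
    exact ((hasFDerivAt_fst (𝕜 := ℂ)).comp_hasDerivAt (0 : ℂ) hw).deriv.symm
  have hp : HasFDerivAt C.param (fderiv ℂ C.param (C.coord (φ 0))) (C.coord (φ 0)) :=
    (C.analyticOnNhd_param _ hb).differentiableAt.hasFDerivAt
  let l : ℂ → (Fin a → ℂ) × (Fin b → ℂ) × K := fun z => C.coord (φ 0) + z • w'
  have hl : HasDerivAt l w' 0 :=
    HasDerivAt.const_add _ (by simpa using (hasDerivAt_id (0 : ℂ)).smul_const w')
  have hl0 : l 0 = C.coord (φ 0) := by simp [l]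
  have h1 : HasDerivAt φ (fderiv ℂ C.param (C.coord (φ 0)) w') 0 :=
    (hp.comp_hasDerivAt (0 : ℂ) hw).congr_of_eventuallyEq
      (hmem.mono fun z hz => (C.param_coord _ hz).symm)
  have h2 : HasDerivAt (fun z => C.param (l z)) (fderiv ℂ C.param (C.coord (φ 0)) w') 0 :=
    (hl0 ▸ hp : HasFDerivAt C.param (fderiv ℂ C.param (C.coord (φ 0))) (l 0)).comp_hasDerivAt
      (0 : ℂ) hl
  have h3 := deriv_mem_tangentSpaceAt (M := A) h2.differentiableAt (by
    filter_upwards [hl.continuousAt.eventually (Metric.isOpen_ball.mem_nhds (hl0 ▸ hb))] with z hz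
    have hm := C.param_mem _ hz
    refine (C.mem_left _ hm.1).2 ⟨hm.2, ?_⟩
    rw [C.coord_param _ hz]
    simp only [l, Prod.fst_add, Prod.smul_fst, hw1, smul_zero, add_zero]
    exact ((C.mem_left _ hx.1).1 h0).2)
  rw [h2.deriv, hl0, C.param_coord _ hx, ← h1.deriv] at h3
  exact hd h3

/-- Read the disc in the chart. Transversality to `A` makes its first coordinate immersed at the
centre; avoiding `B` keeps its second coordinate nonzero on the whole disc, which contracts that
component of the loop. -/
theorem exists_meridian_of_isSimpleLoopAround {t₀ : C.Model}
    {η : Path (C.point t₀) (C.point t₀)} (h : IsSimpleLoopAround ((U ∩ S) \ B) A η) :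
    ∃ η' : Path t₀ t₀, η'.map C.continuous_point = η ∧ IsMeridian (η'.map continuous_fst) ∧
      (η'.map (continuous_fst.comp continuous_snd)).Homotopic (Path.refl _) := by
  obtain ⟨φ, γ, c, hφ, h0, hd, hne, hc, hγ, rfl⟩ := h
  have hY : ∀ z : ℂ, ‖z‖ ≤ 1 → φ z ∈ (U ∩ S) \ B := fun z hz => by
    by_cases hz0 : z = 0
    · exact hz0 ▸ h0.1
    · exact (hne z hz hz0).1
  have hΩ : ∀ z : ℂ, ‖z‖ ≤ 1 → z ≠ 0 → φ z ∈ (U ∩ S) \ (A ∪ B) := fun z hz hz0 =>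
    ⟨(hY z hz).1, fun h => h.elim (hne z hz hz0).2 (hY z hz).2⟩
  have hcoord : AnalyticOnNhd ℂ (fun z => C.coord (φ z)) (Metric.closedBall 0 1) := fun z hz =>
    (C.analyticOnNhd_coord _ (hY z (by simpa using hz)).1.1).comp (hφ z hz)
  have hball := fun z hz => mem_ball_iff.1 (C.coord_mem _ (hY z hz).1)
  obtain ⟨γ', hγ'⟩ := C.exists_lift_path γ (fun t => ⟨(hγ t).1.1, fun h => h.elim (hγ t).2
    (hγ t).1.2⟩) rfl (C.point_toModel (φ 1) (hΩ 1 (by simp) one_ne_zero))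
  obtain ⟨c', hc'⟩ := C.exists_lift_path c (fun t => by
    rw [hc]; exact hΩ _ (norm_exp_two_pi_mul t).le (Complex.exp_ne_zero _))
    (C.point_toModel (φ 1) (hΩ 1 (by simp) one_ne_zero))
    (C.point_toModel (φ 1) (hΩ 1 (by simp) one_ne_zero))
  have hcv : ∀ t : unitInterval, C.val (c' t) =
      C.coord (φ (Complex.exp (2 * Real.pi * Complex.I * (t : ℝ)))) := fun t => by
    rw [← C.coord_point, hc', hc]
  refine ⟨(γ'.trans c').trans γ'.symm, ?_, ?_, ?_⟩
  · refine Path.ext (funext fun t => ?_)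
    simp only [Path.map_coe, Function.comp_apply, Path.trans_apply]
    split_ifs <;> simp [hγ', hc']
  · refine ⟨fun z => (C.coord (φ z)).1, _, γ'.map continuous_fst, c'.map continuous_fst,
      fun z hz => analyticAt_fst.comp_of_eq (hcoord z hz) rfl,
      ((C.mem_left _ h0.1.1.1).1 h0.2).2, ?_,
      fun z hz => by simpa using (hball z hz).1, fun z hz hz0 h => ?_,
      fun t => congrArg Prod.fst (hcv t), ?_⟩
    · refine C.deriv_coord_fst_ne_zero (hφ 0 (by simp)).differentiableAt ?_ h0.2 hd
      filter_upwards [Metric.closedBall_mem_nhds (0 : ℂ) one_pos] with z hz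
      exact (hY z (by simpa using hz)).1
    · exact (hne z hz hz0).2 ((C.mem_left _ (hY z hz).1.1).2 ⟨(hY z hz).1.2, h⟩)
    · rw [Path.map_trans, Path.map_trans, Path.map_symm]
  · rw [Path.map_trans, Path.map_trans, ← Path.map_symm]
    refine Path.homotopic_refl_of_disc _ _ ⟨fun z => ⟨(C.coord (φ z)).2.1,
      (hball z (mem_closedBall_zero_iff.1 z.2)).2.1, fun h => (hY z (mem_closedBall_zero_iff.1 z.2)).2 ((C.mem_right _
        (hY z (mem_closedBall_zero_iff.1 z.2)).1.1).2 ⟨(hY z (mem_closedBall_zero_iff.1 z.2)).1.2, h⟩)⟩, ?_⟩ fun t _ => ?_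
    · have h1 : Continuous fun z : Metric.closedBall (0 : ℂ) 1 => C.coord (φ z) :=
        continuousOn_iff_continuous_domRestrict.1 hcoord.continuousOn
      fun_prop
    · ext1
      exact congrArg (fun z => z.2.1) (hcv t)

/-- Scaling the first coordinate of the base point by `z` gives a disc with the base point on its
boundary, so a constant connecting path suffices. -/
theorem exists_isSimpleLoopAround (t₀ : C.Model) :
    ∃ η : Path (C.point t₀) (C.point t₀), IsSimpleLoopAround ((U ∩ S) \ B) A η := by
  let l : ℂ → (Fin a → ℂ) × (Fin b → ℂ) × K := fun z => (z • t₀.1.1, t₀.2.1.1, t₀.2.2.1)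
  have hl : ∀ z, ‖z‖ ≤ 1 → l z ∈ Metric.ball 0 C.r := fun z hz => by
    have h := mem_ball_iff.1 (C.val_mem t₀)
    refine mem_ball_iff.2 ⟨?_, h.2⟩
    have h1 : ‖(t₀.1 : Fin a → ℂ)‖ < C.r := by simpa [val] using h.1
    simp only [l, Metric.mem_ball, dist_zero_right, norm_smul]
    nlinarith [norm_nonneg (t₀.1 : Fin a → ℂ)]
  have hld : HasDerivAt l (t₀.1.1, 0, 0) 0 := by
    refine HasDerivAt.prodMk ?_ (hasDerivAt_const (0 : ℂ) _)
    simpa using (hasDerivAt_id (0 : ℂ)).smul_const t₀.1.1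
  have hla : ∀ z, AnalyticAt ℂ l z := fun z =>
    (analyticAt_id.smul analyticAt_const).prod analyticAt_const
  let φ : ℂ → E := fun z => C.param (l z)
  have hφm := fun z hz => C.param_mem _ (hl z hz)
  have hB : ∀ z, ‖z‖ ≤ 1 → φ z ∉ B := fun z hz h => by
    have h1 := ((C.mem_right _ (hφm z hz).1).1 h).2
    rw [C.coord_param _ (hl z hz)] at h1
    exact t₀.2.1.2.2 h1
  have hA : ∀ z, ‖z‖ ≤ 1 → (φ z ∈ A ↔ z = 0) := fun z hz => by
    have h1 := C.mem_left _ (hφm z hz).1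
    rw [C.coord_param _ (hl z hz)] at h1
    rw [h1, and_iff_right (hφm z hz).2, smul_eq_zero]
    exact or_iff_left fun h => t₀.1.2.2 h
  have h00 : ‖(0 : ℂ)‖ ≤ 1 := by simp
  have h1 : C.point t₀ = φ 1 := by simp [φ, l, point, val]
  let c : Path (φ 1) (φ 1) :=
    { toFun := fun t => φ (Complex.exp (2 * Real.pi * Complex.I * (t : ℝ)))
      continuous_toFun := by
        refine C.analyticOnNhd_param.continuousOn.comp_continuous (f := fun t : unitInterval =>
          l (Complex.exp (2 * Real.pi * Complex.I * (t : ℝ)))) (by fun_prop) fun t => ?_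
        exact hl _ (norm_exp_two_pi_mul t).le
      source' := by simp
      target' := by simp }
  refine ⟨_, φ, (Path.refl (C.point t₀)).cast rfl h1.symm, c, fun z hz => ?_, ⟨⟨hφm 0 h00, hB 0 h00⟩,
    (hA 0 h00).2 rfl⟩, fun h => ?_, fun z hz hz0 => ⟨⟨hφm z hz, hB z hz⟩, fun h =>
    hz0 ((hA z hz).1 h)⟩, fun t => rfl, fun t => ?_, rfl⟩
  · exact (C.analyticOnNhd_param _ (hl z (by simpa using hz))).comp (hla z)
  · have hc : AnalyticAt ℂ C.coord (φ 0) := C.analyticOnNhd_coord _ (hφm 0 h00).1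
    have h2 := fderiv_eq_zero_of_mem_tangentSpaceAt (F := fun y => (C.coord y).1)
      (differentiableAt_fst.comp _ hc.differentiableAt) ((hA 0 h00).2 rfl) (by
        filter_upwards [C.isOpen.mem_nhds (hφm 0 h00).1] with y hy h
        exact ((C.mem_left y hy).1 h).2) h
    have hφd : HasDerivAt φ (deriv φ 0) 0 :=
      ((C.analyticOnNhd_param _ (hl 0 h00)).comp (hla 0)).differentiableAt.hasDerivAt
    have h3 : HasDerivAt (fun z => (C.coord (φ z)).1) (0 : Fin a → ℂ) 0 := by
      rw [← h2]
      exact (DifferentiableAt.hasFDerivAt (f := fun y => (C.coord y).1)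
        (differentiableAt_fst.comp _ hc.differentiableAt)).comp_hasDerivAt (0 : ℂ) hφd
    have h4 : HasDerivAt (fun z => (C.coord (φ z)).1) t₀.1.1 0 := by
      refine ((hasFDerivAt_fst (𝕜 := ℂ)).comp_hasDerivAt (0 : ℂ) hld).congr_of_eventuallyEq ?_
      filter_upwards [Metric.closedBall_mem_nhds (0 : ℂ) one_pos] with z hz
      rw [C.coord_param _ (hl z (by simpa using hz))]
      rfl
    exact t₀.1.2.2 (h4.unique h3)
  · have := C.point_mem t₀
    exact ⟨⟨this.1, fun h => this.2 (Or.inr h)⟩, fun h => this.2 (Or.inl h)⟩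

end CrossingChart

/-- A transversal intersection has arbitrarily small crossing charts. -/
theorem IntersectTransversallyAt.exists_crossingChart {E : Type*} [NormedAddCommGroup E]
    [NormedSpace ℂ E] [FiniteDimensional ℂ E] {S A B : Set E} {x : E}
    (h : IntersectTransversallyAt S A B x) {W : Set E} (hW : W ∈ 𝓝 x) :
    ∃ (U : Set E) (a b : ℕ) (K : Submodule ℂ E), U ⊆ W ∧ x ∈ U ∧
      Nonempty (CrossingChart S A B U a b K) := by
  obtain ⟨hxA, hxB, ⟨n, FS, hFS, hS, hS'⟩, ⟨a, FA, hFA, hA, hA'⟩, ⟨b, FB, hFB, hB, hB'⟩, hT⟩ := h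
  have hcE : CompleteSpace E := FiniteDimensional.complete ℂ E
  obtain ⟨hxS, hFA0⟩ := hA.self_of_nhds.1 hxA
  obtain ⟨-, hFB0⟩ := hB.self_of_nhds.1 hxB
  obtain ⟨-, hFS0⟩ := hS.self_of_nhds.1 hxS
  have kS : ∀ v ∈ tangentSpaceAt S x, fderiv ℂ FS x v = 0 := fun v hv =>
    fderiv_eq_zero_of_mem_tangentSpaceAt hFS.differentiableAt hxS
      (hS.mono fun y hy h => (hy.1 h).2) hv
  have kA : ∀ v ∈ tangentSpaceAt A x, fderiv ℂ FA x v = 0 := fun v hv =>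
    fderiv_eq_zero_of_mem_tangentSpaceAt hFA.differentiableAt hxA
      (hA.mono fun y hy h => (hy.1 h).2) hv
  have kB : ∀ v ∈ tangentSpaceAt B x, fderiv ℂ FB x v = 0 := fun v hv =>
    fderiv_eq_zero_of_mem_tangentSpaceAt hFB.differentiableAt hxB
      (hB.mono fun y hy h => (hy.1 h).2) hv
  let F : E → (Fin n → ℂ) × (Fin a → ℂ) × (Fin b → ℂ) := fun y => (FS y, FA y, FB y)
  have hF : AnalyticAt ℂ F x := hFS.prod (hFA.prod hFB)
  have hF0 : F x = 0 := by simp [F, hFA0, hFB0, hFS0]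
  have hFd : HasStrictFDerivAt F ((fderiv ℂ FS x).prod ((fderiv ℂ FA x).prod (fderiv ℂ FB x))) x :=
    hFS.hasStrictFDerivAt.prodMk (hFA.hasStrictFDerivAt.prodMk hFB.hasStrictFDerivAt)
  set L := (fderiv ℂ FS x).prod ((fderiv ℂ FA x).prod (fderiv ℂ FB x))
  have hsplit : ∀ v ∈ tangentSpaceAt S x, ∃ vA ∈ tangentSpaceAt A x, ∃ vB ∈ tangentSpaceAt B x,
      vA + vB = v := fun v hv => Submodule.mem_sup.1 (hT ▸ hv)
  have hle : tangentSpaceAt A x ≤ tangentSpaceAt S x := hT ▸ le_sup_left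
  have hle' : tangentSpaceAt B x ≤ tangentSpaceAt S x := hT ▸ le_sup_right
  -- Transversality enters here. Reach `w` by a vector `v` tangent to `S`, then correct the
  -- `A`-value by a vector tangent to `B` and the `B`-value by one tangent to `A`; neither
  -- correction disturbs the other values.
  have hL : L.range = ⊤ := by
    refine LinearMap.range_eq_top.2 ?_
    rintro ⟨w, wA, wB⟩
    obtain ⟨v, -, hv⟩ := hS' w
    obtain ⟨u, hu, hu'⟩ := hA' (wA - fderiv ℂ FA x v)
    obtain ⟨u₁, hu₁, u₂, hu₂, rfl⟩ := hsplit u hu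
    obtain ⟨z, hz, hz'⟩ := hB' (wB - fderiv ℂ FB x v)
    obtain ⟨z₁, hz₁, z₂, hz₂, rfl⟩ := hsplit z hz
    rw [map_add, kA _ hu₁, zero_add] at hu'
    rw [map_add, kB _ hz₂, add_zero] at hz'
    refine ⟨v + u₂ + z₁, ?_⟩
    simp only [L, ContinuousLinearMap.coe_coe, ContinuousLinearMap.prod_apply, map_add, hv, hu', hz',
      kS _ (hle' hu₂), kS _ (hle hz₁), kA _ hz₁, kB _ hu₂]
    simp
  have hker : L.ker.ClosedComplemented := Submodule.ClosedComplemented.of_finiteDimensional L.ker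
  set Φ := hFd.implicitToOpenPartialHomeomorphOfComplemented F L hL hker with hΦdef
  have hΦ : ∀ y, Φ y = (F y, Classical.choose hker (y - x)) := fun y =>
    hFd.implicitToOpenPartialHomeomorphOfComplemented_apply hL hker y
  have hΦx : Φ x = 0 := by rw [hΦ, hF0]; simp
  have hxs : x ∈ Φ.source := hFd.mem_implicitToOpenPartialHomeomorphOfComplemented_source hL hker
  have h0t : (0 : ((Fin n → ℂ) × (Fin a → ℂ) × (Fin b → ℂ)) × L.ker) ∈ Φ.target :=
    hΦx ▸ Φ.map_source hxs
  have hsymm0 : Φ.symm 0 = x := by rw [← hΦx, Φ.left_inv hxs]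
  have hΦan : ∀ y, AnalyticAt ℂ F y → AnalyticAt ℂ Φ y := fun y hy => by
    have : (Φ : E → _) = fun y => (F y, Classical.choose hker (y - x)) := funext hΦ
    rw [this]
    exact hy.prod (((Classical.choose hker).analyticAt _).comp (analyticAt_id.sub analyticAt_const))
  have hsymm : AnalyticAt ℂ Φ.symm 0 := by
    have hd := (hFd.implicitFunctionDataOfComplemented F L hL hker).hasStrictFDerivAt.hasFDerivAt
    exact Φ.analyticAt_symm h0t (by rw [hsymm0]; exact hΦan x hF) (by rw [hsymm0]; exact hd.fderiv)
  have hgood : ∀ᶠ y in 𝓝 x, y ∈ W ∧ AnalyticAt ℂ F y ∧ (y ∈ S ↔ FS y = 0) ∧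
      (y ∈ A ↔ y ∈ S ∧ FA y = 0) ∧ (y ∈ B ↔ y ∈ S ∧ FB y = 0) := by
    filter_upwards [hW, hF.eventually_analyticAt, hS, hA, hB] with y h1 h2 h3 h4 h5
    exact ⟨h1, h2, by simpa using h3, h4, h5⟩
  -- On this ball the inverse chart is defined and analytic, and its values lie in `W`, where the
  -- equations of `S`, `A` and `B` hold.
  obtain ⟨r, hr, hball⟩ := Metric.eventually_nhds_iff_ball.1
    (((Φ.open_target.eventually_mem h0t).and hsymm.eventually_analyticAt).and
      (hsymm.continuousAt.eventually (hsymm0.symm ▸ hgood)))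
  have hU : ∀ y ∈ Φ.source ∩ Φ ⁻¹' Metric.ball 0 r, y ∈ W ∧ AnalyticAt ℂ F y ∧
      (y ∈ S ↔ FS y = 0) ∧ (y ∈ A ↔ y ∈ S ∧ FA y = 0) ∧ (y ∈ B ↔ y ∈ S ∧ FB y = 0) := by
    rintro y ⟨hy, hy'⟩
    have := (hball _ hy').2
    rwa [Φ.left_inv hy] at this
  -- Setting the values of the equations of `S` to zero restricts the ambient chart to `S`.
  let j : (Fin a → ℂ) × (Fin b → ℂ) × L.ker → ((Fin n → ℂ) × (Fin a → ℂ) × (Fin b → ℂ)) × L.ker :=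
    fun z => ((0, z.1, z.2.1), z.2.2)
  have hj : ∀ z ∈ Metric.ball 0 r, j z ∈ Metric.ball 0 r := fun z hz => by
    simpa [j, Prod.norm_def, hr, and_assoc] using hz
  have hjmem : ∀ z ∈ Metric.ball 0 r, Φ.symm (j z) ∈ Φ.source ∩ Φ ⁻¹' Metric.ball 0 r := by
    intro z hz
    have ht := (hball _ (hj z hz)).1.1
    exact ⟨Φ.map_target ht, by simpa only [Set.mem_preimage, Φ.right_inv ht] using hj z hz⟩
  have hΦj : ∀ z ∈ Metric.ball 0 r, Φ (Φ.symm (j z)) = j z := fun z hz =>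
    Φ.right_inv (hball _ (hj z hz)).1.1
  have hFst : ∀ y, (Φ y).1 = F y := fun y => by rw [hΦ]
  have hjS : ∀ y, FS y = 0 → j (FA y, FB y, (Φ y).2) = Φ y := fun y hy => by
    refine Prod.ext ?_ rfl
    rw [hFst]
    simp [j, F, hy]
  refine ⟨Φ.source ∩ Φ ⁻¹' Metric.ball 0 r, a, b, L.ker, fun y hy => (hU y hy).1,
    ⟨hxs, by simpa [hΦx] using hr⟩, ⟨{
      param := fun z => Φ.symm (j z)
      coord := fun y => (FA y, FB y, (Φ y).2)
      r := r
      isOpen := Φ.isOpen_inter_preimage Metric.isOpen_ball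
      analyticOnNhd_param := fun z hz => ?_
      analyticOnNhd_coord := fun y hy => ?_
      param_mem := fun z hz => ⟨hjmem z hz, ?_⟩
      coord_mem := fun y hy => ?_
      param_coord := fun y hy => ?_
      coord_param := fun z hz => ?_
      mem_left := fun y hy => (hU y hy).2.2.2.1
      mem_right := fun y hy => (hU y hy).2.2.2.2 }⟩⟩
  · have hja : AnalyticAt ℂ j z := by
      refine AnalyticAt.prod (analyticAt_const.prod (analyticAt_fst.prod ?_)) ?_
      · exact analyticAt_fst.comp analyticAt_snd
      · exact analyticAt_snd.comp analyticAt_snd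
    exact (hball _ (hj z hz)).1.2.comp hja
  · have h1 := (hU y hy).2.1
    have h2 : AnalyticAt ℂ (fun y => (F y).2) y := analyticAt_snd.comp h1
    exact (analyticAt_fst.comp h2).prod ((analyticAt_snd.comp h2).prod
      (analyticAt_snd.comp (hΦan y h1)))
  · have h1 := congrArg (fun q => q.1.1) (hΦj z hz)
    rw [hFst] at h1
    exact (hU _ (hjmem z hz)).2.2.1.2 h1
  · have h1 : j (FA y, FB y, (Φ y).2) ∈ Metric.ball 0 r := by
      rw [hjS y ((hU y hy.1).2.2.1.1 hy.2)]
      exact hy.1.2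
    simpa [j, Prod.norm_def, hr, and_assoc] using h1
  · rw [hjS y ((hU y hy.1).2.2.1.1 hy.2), Φ.left_inv hy.1.1]
  · have h1 := hΦj z hz
    have h2 := hFst (Φ.symm (j z))
    rw [h1] at h2
    have h3 : FA (Φ.symm (j z)) = z.1 := congrArg (fun q => q.2.1) h2.symm
    have h4 : FB (Φ.symm (j z)) = z.2.1 := congrArg (fun q => q.2.2) h2.symm
    rw [h1, h3, h4]

/-! ### Discontinuities around a transversal intersection -/

section Discontinuity

variable {E : Type*} [NormedAddCommGroup E] [NormedSpace ℂ E] {S A B U : Set E}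

theorem IsSimpleLoopAround.mem {Y P : Set E} {p : E} {η : Path p p}
    (h : IsSimpleLoopAround Y P η) (t : unitInterval) : η t ∈ Y \ P := by
  obtain ⟨φ, γ, c, -, -, -, hne, hc, hγ, rfl⟩ := h
  have hc' : ∀ t, c t ∈ Y \ P := fun t => by
    rw [hc]; exact hne _ (norm_exp_two_pi_mul t).le (Complex.exp_ne_zero _)
  simp only [Path.trans_apply]
  split_ifs
  exacts [hγ _, hc' _, hγ _]

/-- The sequential discontinuity is determined by the continuations along loops around `A`, around
`B`, and around `B` and then `A`, provided that these do not depend on the loops. -/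
theorem isSequentialDiscontinuity_iff {Z : Set E} {p : E} {f gA gB h d : Germ (𝓝[S] p) ℂ}
    (hf : ContinuesAlongPathsIn S (Z \ (A ∪ B)) f)
    (huniq : ∀ (γ : Path p p) (f g g' : Germ (𝓝[S] p) ℂ), (∀ t, γ t ∈ Z \ (A ∪ B)) →
      IsContinuation S γ f g → IsContinuation S γ f g' → g = g')
    (hA : ∃ η : Path p p, IsSimpleLoopAround (Z \ B) A η)
    (hB : ∃ η : Path p p, IsSimpleLoopAround (Z \ A) B η)
    (hgA : ∀ (η : Path p p) (g), IsSimpleLoopAround (Z \ B) A η → IsContinuation S η f g → g = gA)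
    (hgB : ∀ (η : Path p p) (g), IsSimpleLoopAround (Z \ A) B η → IsContinuation S η f g → g = gB)
    (hh : ∀ (η η' : Path p p) (g), IsSimpleLoopAround (Z \ A) B η →
      IsSimpleLoopAround (Z \ B) A η' → IsContinuation S (η.trans η') f g → g = h) :
    IsSequentialDiscontinuity S Z A B f d ↔ d = f - gB - (gA - h) := by
  have memA : ∀ η : Path p p, IsSimpleLoopAround (Z \ B) A η → ∀ t, η t ∈ Z \ (A ∪ B) :=
    fun η hη t => ⟨(hη.mem t).1.1, fun h => h.elim (hη.mem t).2 (hη.mem t).1.2⟩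
  have memB : ∀ η : Path p p, IsSimpleLoopAround (Z \ A) B η → ∀ t, η t ∈ Z \ (A ∪ B) :=
    fun η hη t => ⟨(hη.mem t).1.1, fun h => h.elim (hη.mem t).1.2 (hη.mem t).2⟩
  have key : ∀ η η' : Path p p, IsSimpleLoopAround (Z \ A) B η → IsSimpleLoopAround (Z \ B) A η' →
      IsContinuation S η f gB ∧ IsContinuation S η' (f - gB) (gA - h) := by
    intro η η' hη hη'
    have hmem : ∀ t, η.trans η' t ∈ Z \ (A ∪ B) := fun t => by
      rw [Path.trans_apply]
      split_ifs
      exacts [memB η hη _, memA η' hη' _]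
    obtain ⟨k, hk⟩ := hf p (η.trans η') hmem
    obtain ⟨g, hg, hgk⟩ := hk.exists_of_trans
    obtain ⟨g', hg'⟩ := hf p η' (memA η' hη')
    rw [hh η η' k hη hη' hk, hgB η g hη hg] at hgk
    rw [hgA η' g' hη' hg'] at hg'
    -- Along `η'` the germ `f` continues to `gA` and `gB` continues to `h`; subtract.
    exact ⟨hgB η g hη hg ▸ hg, hg'.sub hgk⟩
  constructor
  · rintro ⟨u, ⟨η, g, hη, hg, rfl⟩, ⟨η', g', hη', hg', rfl⟩⟩
    obtain rfl := hgB η g hη hg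
    rw [huniq η' _ _ _ (memA η' hη') hg' (key η η' hη hη').2]
  · rintro rfl
    obtain ⟨η', hη'⟩ := hA
    obtain ⟨η, hη⟩ := hB
    exact ⟨f - gB, ⟨η, gB, hη, (key η η' hη hη').1, rfl⟩,
      ⟨η', gA - h, hη', (key η η' hη hη').2, rfl⟩⟩

namespace CrossingChart

variable {a b : ℕ} {K : Type*} [NormedAddCommGroup K] [NormedSpace ℂ K]

theorem continuation_unique_of_mem (C : CrossingChart S A B U a b K) {p : E}
    (hp : p ∈ (U ∩ S) \ (A ∪ B)) (γ : Path p p) (f g g' : Germ (𝓝[S] p) ℂ)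
    (hγ : ∀ t, γ t ∈ (U ∩ S) \ (A ∪ B)) (h : IsContinuation S γ f g)
    (h' : IsContinuation S γ f g') : g = g' := by
  obtain ⟨t₀, rfl⟩ : ∃ t, C.point t = p := ⟨_, C.point_toModel p hp⟩
  obtain ⟨γ', hγ'⟩ := C.exists_lift_path γ hγ rfl rfl
  obtain rfl : γ'.map C.continuous_point = γ := Path.ext (funext hγ')
  exact C.continuation_unique h h'

theorem exists_isSimpleLoopAround_of_mem (C : CrossingChart S A B U a b K) {p : E}
    (hp : p ∈ (U ∩ S) \ (A ∪ B)) : ∃ η : Path p p, IsSimpleLoopAround ((U ∩ S) \ B) A η := by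
  obtain ⟨t₀, rfl⟩ : ∃ t, C.point t = p := ⟨_, C.point_toModel p hp⟩
  exact C.exists_isSimpleLoopAround t₀

/-- The continuation along a simple loop does not depend on the loop. -/
theorem continuation_eq_of_isSimpleLoopAround (C : CrossingChart S A B U a b K) {p : E}
    (hp : p ∈ (U ∩ S) \ (A ∪ B)) {f g g' : Germ (𝓝[S] p) ℂ}
    (hf : ContinuesAlongPathsIn S ((U ∩ S) \ (A ∪ B)) f) {η η' : Path p p}
    (hη : IsSimpleLoopAround ((U ∩ S) \ B) A η) (hη' : IsSimpleLoopAround ((U ∩ S) \ B) A η')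
    (h : IsContinuation S η f g) (h' : IsContinuation S η' f g') : g = g' := by
  obtain ⟨t₀, rfl⟩ : ∃ t, C.point t = p := ⟨_, C.point_toModel p hp⟩
  obtain ⟨ζ, rfl, h1, h2⟩ := C.exists_meridian_of_isSimpleLoopAround hη
  obtain ⟨ζ', rfl, h1', h2'⟩ := C.exists_meridian_of_isSimpleLoopAround hη'
  exact C.continuation_eq_of_homotopic
    (C.homotopic_of_components (h1.homotopic h1') (h2.trans h2'.symm)) hf h h'

/-- Continuations along simple loops around the two submanifolds commute. -/
theorem continuation_trans_comm (C : CrossingChart S A B U a b K) {p : E}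
    (hp : p ∈ (U ∩ S) \ (A ∪ B)) {f g g' : Germ (𝓝[S] p) ℂ}
    (hf : ContinuesAlongPathsIn S ((U ∩ S) \ (A ∪ B)) f) {η η' θ θ' : Path p p}
    (hη : IsSimpleLoopAround ((U ∩ S) \ B) A η) (hη' : IsSimpleLoopAround ((U ∩ S) \ B) A η')
    (hθ : IsSimpleLoopAround ((U ∩ S) \ A) B θ) (hθ' : IsSimpleLoopAround ((U ∩ S) \ A) B θ')
    (h : IsContinuation S (η.trans θ) f g) (h' : IsContinuation S (θ'.trans η') f g') :
    g = g' := by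
  obtain ⟨t₀, rfl⟩ : ∃ t, C.point t = p := ⟨_, C.point_toModel p hp⟩
  obtain ⟨η, rfl, hη1, hη2⟩ := C.exists_meridian_of_isSimpleLoopAround hη
  obtain ⟨η', rfl, hη1', hη2'⟩ := C.exists_meridian_of_isSimpleLoopAround hη'
  have right : ∀ {θ : Path (C.point t₀) (C.point t₀)}, IsSimpleLoopAround ((U ∩ S) \ A) B θ →
      ∃ ζ : Path t₀ t₀, ζ.map C.continuous_point = θ ∧
        (ζ.map continuous_fst).Homotopic (Path.refl _) ∧
        IsMeridian (ζ.map (continuous_fst.comp continuous_snd)) := fun {θ} hθ => by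
    let s : C.swap.Model → C.Model := fun t => (t.2.1, t.1, t.2.2)
    have hs : Continuous s := by fun_prop
    obtain ⟨ζ, hζ, h1, h2⟩ :=
      C.swap.exists_meridian_of_isSimpleLoopAround (t₀ := (t₀.2.1, t₀.1, t₀.2.2)) (η := θ) hθ
    exact ⟨ζ.map hs, hζ, h2, h1⟩
  obtain ⟨θ, rfl, hθ1, hθ2⟩ := right hθ
  obtain ⟨θ', rfl, hθ1', hθ2'⟩ := right hθ'
  rw [← Path.map_trans] at h h'
  refine C.continuation_eq_of_homotopic (C.homotopic_of_components ?_ ?_) hf h h'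
  -- In the first factor both products reduce to a meridian, the loops around `B` being trivial
  -- there. The second factor is symmetric.
  · rw [Path.map_trans, Path.map_trans]
    have e1 := ((hη1.homotopic hη1').hcomp hθ1).trans ⟨Path.Homotopy.transRefl _⟩
    have e2 := (hθ1'.hcomp (Path.Homotopic.refl (η'.map continuous_fst))).trans
      ⟨Path.Homotopy.reflTrans _⟩
    exact e1.trans e2.symm
  · rw [Path.map_trans, Path.map_trans]
    have e1 := (hη2.hcomp (hθ2.homotopic hθ2')).trans ⟨Path.Homotopy.reflTrans _⟩
    have e2 := ((Path.Homotopic.refl (θ'.map (continuous_fst.comp continuous_snd))).hcomp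
      hη2').trans ⟨Path.Homotopy.transRefl _⟩
    exact e1.trans e2.symm

theorem existsUnique_isDiscontinuity (C : CrossingChart S A B U a b K) {p : E}
    (hp : p ∈ (U ∩ S) \ (A ∪ B)) {f : Germ (𝓝[S] p) ℂ}
    (hf : ContinuesAlongPathsIn S ((U ∩ S) \ (A ∪ B)) f) :
    ∃! d, IsDiscontinuity S ((U ∩ S) \ B) A f d := by
  obtain ⟨η, hη⟩ := C.exists_isSimpleLoopAround_of_mem hp
  obtain ⟨g, hg⟩ := hf p η fun t =>
    ⟨(hη.mem t).1.1, fun h => h.elim (hη.mem t).2 (hη.mem t).1.2⟩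
  refine ⟨f - g, ⟨η, g, hη, hg, rfl⟩, ?_⟩
  rintro _ ⟨η', g', hη', hg', rfl⟩
  rw [C.continuation_eq_of_isSimpleLoopAround hp hf hη hη' hg hg']

theorem exists_sequentialDiscontinuity (C : CrossingChart S A B U a b K) {p : E}
    (hp : p ∈ (U ∩ S) \ (A ∪ B)) {f : Germ (𝓝[S] p) ℂ}
    (hf : ContinuesAlongPathsIn S ((U ∩ S) \ (A ∪ B)) f) :
    ∃ d : Germ (𝓝[S] p) ℂ, (∀ d', IsSequentialDiscontinuity S (U ∩ S) A B f d' ↔ d' = d) ∧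
      ∀ d', IsSequentialDiscontinuity S (U ∩ S) B A f d' ↔ d' = d := by
  have hp' : p ∈ (U ∩ S) \ (B ∪ A) := by rwa [Set.union_comm]
  have hf' : ContinuesAlongPathsIn S ((U ∩ S) \ (B ∪ A)) f := by rwa [Set.union_comm]
  obtain ⟨η, hη⟩ := C.exists_isSimpleLoopAround_of_mem hp
  obtain ⟨θ, hθ⟩ := C.swap.exists_isSimpleLoopAround_of_mem hp'
  have memη : ∀ t, η t ∈ (U ∩ S) \ (A ∪ B) := fun t =>
    ⟨(hη.mem t).1.1, fun h => h.elim (hη.mem t).2 (hη.mem t).1.2⟩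
  have memθ : ∀ t, θ t ∈ (U ∩ S) \ (A ∪ B) := fun t =>
    ⟨(hθ.mem t).1.1, fun h => h.elim (hθ.mem t).1.2 (hθ.mem t).2⟩
  have mem_trans : ∀ γ γ' : Path p p, (∀ t, γ t ∈ (U ∩ S) \ (A ∪ B)) →
      (∀ t, γ' t ∈ (U ∩ S) \ (A ∪ B)) → ∀ t, γ.trans γ' t ∈ (U ∩ S) \ (A ∪ B) := by
    intro γ γ' h h' t
    rw [Path.trans_apply]
    split_ifs
    exacts [h _, h' _]
  obtain ⟨gA, hgA⟩ := hf p η memη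
  obtain ⟨gB, hgB⟩ := hf p θ memθ
  obtain ⟨h, hh⟩ := hf p (η.trans θ) (mem_trans _ _ memη memθ)
  obtain ⟨h', hh'⟩ := hf p (θ.trans η) (mem_trans _ _ memθ memη)
  have hhh : h = h' := C.continuation_trans_comm hp hf hη hη hθ hθ hh hh'
  have uA : ∀ (ζ : Path p p) (g), IsSimpleLoopAround ((U ∩ S) \ B) A ζ →
      IsContinuation S ζ f g → g = gA := fun ζ g hζ hg =>
    C.continuation_eq_of_isSimpleLoopAround hp hf hζ hη hg hgA
  have uB : ∀ (ζ : Path p p) (g), IsSimpleLoopAround ((U ∩ S) \ A) B ζ →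
      IsContinuation S ζ f g → g = gB := fun ζ g hζ hg =>
    C.swap.continuation_eq_of_isSimpleLoopAround hp' hf' hζ hθ hg hgB
  refine ⟨f - gB - (gA - h), fun d => isSequentialDiscontinuity_iff hf
    (C.continuation_unique_of_mem hp) ⟨η, hη⟩ ⟨θ, hθ⟩ uA uB fun ζ ζ' g hζ hζ' hg =>
      (C.continuation_trans_comm hp hf hη hζ' hθ hζ hh hg).symm, fun d => ?_⟩
  -- The expansion is symmetric in `A` and `B` once `h` is known to be the same for both orders.
  rw [show f - gB - (gA - h) = f - gA - (gB - h) by abel]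
  exact isSequentialDiscontinuity_iff hf' (C.swap.continuation_unique_of_mem hp') ⟨θ, hθ⟩ ⟨η, hη⟩
    uB uA fun ζ ζ' g hζ hζ' hg =>
      (C.continuation_trans_comm hp hf hζ hη hζ' hθ hg hh').trans hhh.symm

end CrossingChart

end Discontinuity

/-! ### Sequential discontinuities at transversal Pham loci -/

theorem theorem4 {X : Type} [Fintype X] (s : ℕ) (G : FeynmanGraph X) (C₁ C₂ : Set G.Eint)
    (pstar : X → Fin (s + 1) → ℂ)
    (htrans : IntersectTransversallyAt (G.extOnShell s) (G.phamLocus s C₁) (G.phamLocus s C₂)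
      pstar) :
    ∀ W ∈ 𝓝 pstar, ∃ U ⊆ W, IsOpen U ∧ pstar ∈ U ∧
      ∀ p ∈ (U ∩ G.extOnShell s) \ (G.phamLocus s C₁ ∪ G.phamLocus s C₂),
      ∀ f : Germ (𝓝[G.extOnShell s] p) ℂ, G.IsBranch s f →
        ContinuesAlongPathsIn (G.extOnShell s)
          ((U ∩ G.extOnShell s) \ (G.phamLocus s C₁ ∪ G.phamLocus s C₂)) f →
        (∃! d, IsDiscontinuity (G.extOnShell s) ((U ∩ G.extOnShell s) \ G.phamLocus s C₂)
          (G.phamLocus s C₁) f d) ∧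
        (∃! d, IsDiscontinuity (G.extOnShell s) ((U ∩ G.extOnShell s) \ G.phamLocus s C₁)
          (G.phamLocus s C₂) f d) ∧
        ∃ d : Germ (𝓝[G.extOnShell s] p) ℂ,
          (∀ d', IsSequentialDiscontinuity (G.extOnShell s) (U ∩ G.extOnShell s)
            (G.phamLocus s C₁) (G.phamLocus s C₂) f d' ↔ d' = d) ∧
          (∀ d', IsSequentialDiscontinuity (G.extOnShell s) (U ∩ G.extOnShell s)
            (G.phamLocus s C₂) (G.phamLocus s C₁) f d' ↔ d' = d) := by
  intro W hW
  obtain ⟨U, a, b, K, hUW, hxU, ⟨C⟩⟩ := htrans.exists_crossingChart hW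
  refine ⟨U, hUW, C.isOpen, hxU, fun p hp f _ hf => ⟨C.existsUnique_isDiscontinuity hp hf, ?_,
    C.exists_sequentialDiscontinuity hp hf⟩⟩
  rw [Set.union_comm] at hp hf
  exact C.swap.existsUnique_isDiscontinuity hp hf
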